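/- Setting. Let $n\ge 2$. Let $\vec G$ be a strongly connected, loopless, weighted directed multigraph with $n$ vertices and $m$ edges that is Eulerian (weighted in-degree equals weighted out-degree at every vertex), whose edge weights are powers of two $2^k$, $k\in\mathbb{N}$, bounded by $n^{a}$ for a constant $a$. Let $\mathbf L_{\vec G}=\mathbf D_{\vec G}-\mathbf A_{\vec G}^{\top}$ be its directed Laplacian ($\mathbf D_{\vec G}$ is the diagonal matrix of weighted out-degrees), let $G$ be the undirected graph in which each arc becomes an undirected edge of half its weight, and let $\mathbf L_G=\frac12(\mathbf L_{\vec G}+\mathbf L_{\vec G}^{\top})$ be its Laplacian. Let $\mathbf r$ be 2-approximate effective resistances: $\frac12\mathbf b_e^\top\mathbf L_G^+\mathbf b_e\le r_e\le 2\,\mathbf b_e^\top\mathbf L_G^+\mathbf b_e$ for every edge $e=(u,v)$, where $\mathbf b_e=\mathbf e_u-\mathbf e_v$. Let $\mathrm{CD}$ be an algorithm that, for every loopless unweighted undirected multigraph with $n$ vertices and $m'$ edges, returns in at most $T_{\mathrm{CD}}(m',n)$ steps an $(\hat m,L)$-short cycle decomposition, i.e. edge-disjoint simple cycles of length at most $L$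 that cover all but at most $\hat m$ of the edges. Let $\theta$ be an integer with $1\le\theta\le n$. Algorithm CycleSparsifyOnce. Put all edges with $w_er_e>4n/m$ into $\vec H$, where $w_e$ is the weight of $e$ in $G$, and remove them from $\vec G$. Partition the remaining edges into classes $\vec G_i$ of equal weight $2^i$. Add to $\vec H$ every class with fewer than $\theta$ edges. For every other class, decompose the underlying undirected graph of $\vec G_i$ with $\mathrm{CD}$ and add the edges of $\vec G_i$ outside the cycles to $\vec H$; then, independently for each cycle, with probability $1/2$ each, add to $\vec H$ either all clockwise edges or all counter-clockwise edges of the cycle, with twice their weight. Return $\vec H$. Lemma. (1) The output $\vec H$ is always a directed Eulerian graph whose edge weights are powers of two. (2) For every $c>0$ there are constants $C,E>0$, depending only on $a$ and $c$, such that if $m\ge C(\hat m\log n+nL^2\log n)$, then with probability at least $1-n^{-c}$ both $\vec H$ has at most $\frac{15}{16}m$ edges and \[ \left\| \mathbf L_G^{+/2}(\mathbf L_{\vec G}-\mathbf L_{\vec H})\mathbf L_G^{+/2}\right\|\le E\sqrt{\frac{nL^2\log n}{m}} . \] (3) If $T_{\mathrm{CD}}(\cdot,n)$ is nondecreasing and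 super-additive in the sense that $\sum_i T_{\mathrm{CD}}(m_i,n)\le T_{\mathrm{CD}}(\sum_i m_i,n)$ for all $m_i\ge\theta$, then the algorithm always takes at most $K m+T_{\mathrm{CD}}(m,n)$ steps, where the constant $K$ depends only on $a$. Here logarithms are to base 2. -/

import Mathlib

noncomputable section

namespace CycleSparsify

/-! ### Weighted directed multigraphs and their Laplacians -/

/-- An arc on the vertex set `Fin n`, with its (integral) weight. -/
structure Arc (n : ℕ) where
  tail : Fin n
  head : Fin n
  weight : ℕ

/-- A weighted directed multigraph on the vertex set `Fin n`, as the array of its arcs; parallel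
arcs are separate entries. The number of edges is the length. -/
abbrev DiGraph (n : ℕ) := List (Arc n)

variable {n : ℕ}

/-- Weighted out-degree. -/
def outDeg (G : DiGraph n) (u : Fin n) : ℕ :=
  ((G.filter fun e => e.tail = u).map Arc.weight).sum

/-- Weighted in-degree. -/
def inDeg (G : DiGraph n) (u : Fin n) : ℕ :=
  ((G.filter fun e => e.head = u).map Arc.weight).sum

/-- Weighted in-degree equals weighted out-degree at every vertex. -/
def IsEulerian (G : DiGraph n) : Prop := ∀ u, inDeg G u = outDeg G u

def Loopless (G : DiGraph n) : Prop := ∀ e ∈ G, e.tail ≠ e.head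

/-- All weights are (integral) powers of two. -/
def PowTwoWeights (G : DiGraph n) : Prop := ∀ e ∈ G, ∃ k : ℕ, e.weight = 2 ^ k

def StronglyConnected (G : DiGraph n) : Prop :=
  ∀ u v, Relation.ReflTransGen (fun x y => ∃ e ∈ G, e.tail = x ∧ e.head = y) u v

/-- `A u v` is the total weight of the arcs from `u` to `v`. -/
def adjMatrix (G : DiGraph n) : Matrix (Fin n) (Fin n) ℝ :=
  Matrix.of fun u v =>
    ((((G.filter fun e => e.tail = u ∧ e.head = v).map Arc.weight).sum : ℕ) : ℝ)

/-- The directed Laplacian `D - Aᵀ`, where `D` is the diagonal matrix of the out-degrees. -/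
def dirLaplacian (G : DiGraph n) : Matrix (Fin n) (Fin n) ℝ :=
  Matrix.diagonal (fun u => (outDeg G u : ℝ)) - (adjMatrix G).transpose

/-- The Laplacian `(L + Lᵀ) / 2` of the undirected graph underlying an Eulerian graph, in which
every arc becomes an undirected edge of half its weight. -/
def undirLaplacian (G : DiGraph n) : Matrix (Fin n) (Fin n) ℝ :=
  (1 / 2 : ℝ) • (dirLaplacian G + (dirLaplacian G).transpose)

/-- The pseudoinverse of a symmetric matrix: nonzero eigenvalues are inverted, and the kernel
stays (recall `0⁻¹ = 0`). -/
def pinv (A : Matrix (Fin n) (Fin n) ℝ) : Matrix (Fin n) (Fin n) ℝ :=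
  cfc (fun x : ℝ => x⁻¹) A

/-- The square root of the pseudoinverse of a positive semidefinite matrix. -/
def pinvSqrt (A : Matrix (Fin n) (Fin n) ℝ) : Matrix (Fin n) (Fin n) ℝ :=
  cfc (fun x : ℝ => (Real.sqrt x)⁻¹) A

/-- The operator norm with respect to the Euclidean norm. -/
def opNorm (A : Matrix (Fin n) (Fin n) ℝ) : ℝ := ‖Matrix.toEuclideanCLM (𝕜 := ℝ) A‖

/-- The effective resistance between `u` and `v` in the underlying undirected graph. -/
def effRes (G : DiGraph n) (u v : Fin n) : ℝ :=
  let b : Fin n → ℝ := Pi.single u 1 - Pi.single v 1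
  dotProduct b ((pinv (undirLaplacian G)).mulVec b)

/-- `r` approximates the effective resistances of all edges within the factor `α`. -/
def ApproxEffRes (α : ℝ) (G : DiGraph n) (r : Fin G.length → ℝ) : Prop :=
  ∀ i, α⁻¹ * effRes G (G.get i).tail (G.get i).head ≤ r i ∧
    r i ≤ α * effRes G (G.get i).tail (G.get i).head

/-- The normalized error `‖L_G^{+/2} (L_{G⃗} - L_{H⃗}) L_G^{+/2}‖` of `H` as an approximation
of `G`. -/
def approxError (G H : DiGraph n) : ℝ :=
  opNorm (pinvSqrt (undirLaplacian G) * (dirLaplacian G - dirLaplacian H) *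
    pinvSqrt (undirLaplacian G))

/-! ### Computations with a step count -/

/-- A deterministic computation: its result and the number of its steps. -/
structure Timed (α : Type) where
  val : α
  steps : ℕ

instance : Monad Timed where
  pure a := ⟨a, 0⟩
  bind x f := ⟨(f x.val).val, x.steps + (f x.val).steps⟩

/-- One elementary operation with result `a`. It is used for single unit-cost RAM operations only:
arithmetic and comparison of two numbers, the exponent of a power of two, a read or a write of one
array cell, the creation of one record or one list cell. -/
def op {α : Type} (a : α) : Timed α := ⟨a, 1⟩

/-- One step of loop or procedure control. -/
def tick : Timed Unit := ⟨(), 1⟩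

/-- A randomized computation: the joint distribution of its result and the number of its steps. -/
def RandTimed (α : Type) : Type := PMF (α × ℕ)

instance : Monad RandTimed where
  pure a := PMF.pure (a, 0)
  bind x f := PMF.bind x fun p => PMF.map (fun q => (q.1, p.2 + q.2)) (f p.1)

instance : MonadLift Timed RandTimed where
  monadLift x := PMF.pure (x.val, x.steps)

/-- A fair coin flip, at unit cost. -/
def coin : RandTimed Bool := PMF.map (fun b => (b, 1)) (PMF.uniformOfFintype Bool)

/-- The possible outcomes (result and number of steps) of a randomized computation. -/
def RandTimed.outcomes {α : Type} (x : RandTimed α) : Set (α × ℕ) := PMF.support x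

/-- The probability that the result has the property `P`. -/
def RandTimed.prob {α : Type} (x : RandTimed α) (P : α → Prop) : ENNReal :=
  PMF.toOuterMeasure x {p | P p.1}

/-! ### Short cycle decompositions -/

/-- The output of a cycle decomposition of a graph with vertices `Fin n` and edges `Fin m`: a list
of cycles and the list of the remaining edges. A cycle `v₁ e₁ v₂ e₂ … v_k e_k (v₁)` is listed as
`(v₁, e₁), …, (v_k, e_k)`. -/
structure CycleDecomp (n m : ℕ) where
  cycles : List (List (Fin n × Fin m))
  rest : List (Fin m)

/-- `C` is a simple cycle (two parallel edges form a cycle of length 2) of the undirected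
multigraph in which the edge `j` has the end points `ends j`. -/
def IsCycle {n m : ℕ} (ends : Fin m → Sym2 (Fin n)) (C : List (Fin n × Fin m)) : Prop :=
  C ≠ [] ∧ (C.map Prod.fst).Nodup ∧ (C.map Prod.snd).Nodup ∧
    ∀ (i : ℕ) (h : i < C.length),
      ends (C[i]'h).2 =
        s((C[i]'h).1, (C[(i + 1) % C.length]'(Nat.mod_lt _ (Nat.zero_lt_of_lt h))).1)

/-- `D` is an `(mhat, L)`-short cycle decomposition: every edge occurs exactly once, either in one
of the cycles, which have length at most `L`, or among the at most `mhat` remaining edges. -/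
def IsShortCycleDecomp {n m : ℕ} (ends : Fin m → Sym2 (Fin n)) (mhat L : ℕ)
    (D : CycleDecomp n m) : Prop :=
  (D.cycles.flatten.map Prod.snd ++ D.rest).Perm (List.finRange m) ∧
    (∀ C ∈ D.cycles, IsCycle ends C ∧ C.length ≤ L) ∧ D.rest.length ≤ mhat

/-- An algorithm that decomposes unweighted undirected multigraphs on `n` vertices. -/
abbrev CycleAlg (n : ℕ) := (m : ℕ) → (Fin m → Sym2 (Fin n)) → Timed (CycleDecomp n m)

/-- On every loopless multigraph on `n` vertices, with any number `m` of edges, `CD` returns an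
`(mhat, L)`-short cycle decomposition in at most `T m` steps. -/
def IsShortCycleAlg (CD : CycleAlg n) (mhat L : ℕ) (T : ℕ → ℕ) : Prop :=
  ∀ (m : ℕ) (ends : Fin m → Sym2 (Fin n)), (∀ j, ¬ (ends j).IsDiag) →
    IsShortCycleDecomp ends mhat L (CD m ends).val ∧ (CD m ends).steps ≤ T m

/-- `∑ i, T (m i) ≤ T (∑ i, m i)` whenever all `m i` are at least `θ`. -/
def SuperAdditiveFrom (θ : ℕ) (T : ℕ → ℕ) : Prop :=
  ∀ ms : List ℕ, (∀ x ∈ ms, θ ≤ x) → (ms.map T).sum ≤ T ms.sum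

/-! ### One round of sparsification -/

/-- Splits a cycle of the undirected graph, whose edge `j` stems from the arc `arc j`, into its
clockwise arcs and its counter-clockwise arcs; the direction of the first arc is clockwise. -/
def orient {m : ℕ} (arc : Fin m → Arc n) (C : List (Fin n × Fin m)) :
    Timed (List (Arc n) × List (Arc n)) :=
  match C with
  | [] => op ([], [])
  | (v₁, j₁) :: _ => do
    let e₁ ← op (arc j₁)
    let b₁ ← op (decide (e₁.tail = v₁))
    C.foldlM (fun (p : List (Arc n) × List (Arc n)) (x : Fin n × Fin m) => do
      tick
      let e ← op (arc x.2)
      let b ← op (decide (e.tail = x.1))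
      let agrees ← op (b == b₁)
      if agrees then do
        let F ← op (e :: p.1)
        pure (F, p.2)
      else do
        let S ← op (e :: p.2)
        pure (p.1, S)) ([], [])

/-- Adds the arcs of `l` to `H`. -/
def addArcs (H l : List (Arc n)) : Timed (List (Arc n)) := do
  tick
  l.foldlM (fun H e => do
    tick
    op (e :: H)) H

/-- Adds the arcs of `l` to `H` with twice their weight. -/
def addDoubled (H l : List (Arc n)) : Timed (List (Arc n)) := do
  tick
  l.foldlM (fun H e => do
    tick
    let w ← op (2 * e.weight)
    let e' ← op (Arc.mk e.tail e.head w)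
    op (e' :: H)) H

/-- Adds to `H`, with twice their weight, either the clockwise or the counter-clockwise arcs
of the cycle `C`, with probability 1/2 each. -/
def sparsifyCycle {m : ℕ} (arc : Fin m → Arc n) (H : List (Arc n)) (C : List (Fin n × Fin m)) :
    RandTimed (List (Arc n)) := do
  tick
  let p ← orient arc C
  let b ← coin
  if b then addDoubled H p.1 else addDoubled H p.2

/-- The length of a list, by one pass over it. -/
def count {α : Type} (l : List α) : Timed ℕ := do
  tick
  l.foldlM (fun k _ => do
    tick
    op (k + 1)) 0

/-- Writes a list into an array; two operations for each entry. -/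
def toArray {α : Type} (l : List α) : Timed (Fin l.length → α) := ⟨l.get, 2 * l.length + 1⟩

/-- The array of the (undirected) end points of an array of arcs; three operations for
each entry. -/
def endsArray {m : ℕ} (arc : Fin m → Arc n) : Timed (Fin m → Sym2 (Fin n)) :=
  ⟨fun j => s((arc j).tail, (arc j).head), 3 * m + 1⟩

/-- Processes the list `l` of all arcs of one weight and adds the result to `H`. A class with fewer
than `θ` arcs is kept as it is; for `θ = 1` every nonempty class is decomposed. -/
def sparsifyClass (CD : CycleAlg n) (θ : ℕ) (H l : List (Arc n)) : RandTimed (List (Arc n)) := do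
  tick
  let k ← count l
  let small ← op (decide (k < θ))
  if small then addArcs H l
  else do
    let arc ← toArray l
    let ends ← endsArray arc
    let D ← CD l.length ends
    let H₁ ← D.rest.foldlM (fun (H : List (Arc n)) j => (do
      tick
      let e ← op (arc j)
      op (e :: H) : Timed (List (Arc n)))) H
    D.cycles.foldlM (sparsifyCycle arc) H₁

/-- The number of weight classes: one more than the largest exponent of a weight. -/
def numClasses (G : DiGraph n) : Timed ℕ := do
  tick
  G.foldlM (fun s e => do
    tick
    let k ← op (Nat.log 2 e.weight)
    let k' ← op (k + 1)
    op (max s k')) 0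

/-- An array of `s` empty lists. -/
def emptyBuckets {α : Type} (s : ℕ) : Timed (ℕ → List α) := ⟨fun _ => [], s + 1⟩

/-- Collects the arcs with `w r > 4 n / m`, where `w` is the weight of the edge in the underlying
undirected graph, that is, half the weight of the arc; all other arcs go into one list for
each weight `2 ^ k`. -/
def split (G : DiGraph n) (r : Fin G.length → ℝ) (B₀ : ℕ → List (Arc n)) :
    Timed (List (Arc n) × (ℕ → List (Arc n))) :=
  (List.finRange G.length).foldlM
    (fun (p : List (Arc n) × (ℕ → List (Arc n))) i => do
      tick
      let e ← op (G.get i)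
      let ri ← op (r i)
      let w ← op ((e.weight : ℝ) / 2)
      let x ← op (w * ri)
      let num ← op (4 * (n : ℝ))
      let bound ← op (num / (G.length : ℝ))
      let heavy ← op (decide (bound < x))
      if heavy then do
        let H ← op (e :: p.1)
        pure (H, p.2)
      else do
        let k ← op (Nat.log 2 e.weight)
        let l ← op (p.2 k)
        let l' ← op (e :: l)
        let B ← op (Function.update p.2 k l')
        pure (p.1, B)) ([], B₀)

/-- One round of sparsification by short cycles of a directed Eulerian graph `G` whose weights are
powers of two, with approximate effective resistances `r` of its edges and the short cycle
decomposition algorithm `CD`. -/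
def cycleSparsifyOnce (CD : CycleAlg n) (θ : ℕ) (G : DiGraph n) (r : Fin G.length → ℝ) :
    RandTimed (DiGraph n) := do
  let s ← numClasses G
  let B₀ ← emptyBuckets s
  let p ← split G r B₀
  (List.range s).foldlM (fun H i => do
    tick
    let l ← op (p.2 i)
    sparsifyClass CD θ H l) p.1

end CycleSparsify

end

open CycleSparsify

namespace CycleSparsify
open Matrix Finset

/-! ### Moments of matrix Rademacher series -/

section Spectral
variable {d : Type} [Fintype d] [DecidableEq d]

/-! Only the multiset of arcs matters. The input splits into kept arcs `B` and short cycles `Z i`,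
each consisting of arcs of one weight; the output is `B` plus, for independent fair signs, the
doubled arcs of one direction of every cycle (`cycleSparsifyOnce_run`). Degree imbalance, Laplacian
and number of arcs are all sums over arcs, so each is read off from this decomposition. On a closed
cycle the clockwise and the counter-clockwise arcs carry the same net flow; hence doubling one side
and dropping the other keeps the graph Eulerian for every outcome. The Laplacian error is, up to
sign, the Rademacher series of the matrices `(Z i).mat`, and the size of the output is `(|B| + m) /
2` plus half a scalar Rademacher sum.

The variance of the matrix series rests on effective resistances. By Foster's theorem at most half
of the arcs are heavy, and every light arc satisfies `w R ≤ 16 n / m`. Effective resistance is a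
pseudometric (the triangle inequality comes from a minimum principle for potentials), so all tails
on a cycle are within the total resistance of the cycle from one base vertex. Because a cycle is
balanced, `matᵀ y` can be written with edge vectors to that base vertex, and Cauchy–Schwarz bounds
its normalized square norm by `L² ρ` times the energy of `y` on the cycle, where `ρ` bounds `w R`.
The sum `mat + matᵀ` is a combination of rank-one edge matrices, which transfers the bound to `mat`.
Disjointness of the cycles makes the energies add up to at most twice the Laplacian form, so both
one-sided variances are `O(n L² / m)` (`cycles_variance_le`).

Concentration is a moment argument. Flipping one sign and telescoping the difference of odd powers
gives a recursion for `E tr S^(2r)` (`sum_trace_pow_succ_le`), a form of the noncommutative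
Khintchine inequality. Markov's inequality with `p ≈ log n` makes the failure probability
polynomially small. The case of `1 × 1` matrices controls the number of arcs.

Step counts are carried through the same composition lemmas as the distributions. The number of
classes is at most `1 + a n`, which is `O(m)` since strong connectivity forces `n ≤ m`. -/

/-- A real symmetric matrix is orthogonally diagonalizable, together with its powers. -/
lemma exists_diagonalization {W : Matrix d d ℝ} (hW : Wᵀ = W) :
    ∃ (U : Matrix d d ℝ) (w : d → ℝ), U * Uᵀ = 1 ∧ Uᵀ * U = 1 ∧
      ∀ a : ℕ, W ^ a = U * diagonal (fun j => w j ^ a) * Uᵀ := by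
  have hH : W.IsHermitian := by rw [IsHermitian, conjTranspose_eq_transpose_of_trivial, hW]
  have e1 : star (hH.eigenvectorUnitary : Matrix d d ℝ) =
      (hH.eigenvectorUnitary : Matrix d d ℝ)ᵀ := by
    rw [star_eq_conjTranspose, conjTranspose_eq_transpose_of_trivial]
  have h1 := Unitary.coe_mul_star_self hH.eigenvectorUnitary
  have h2 := Unitary.coe_star_mul_self hH.eigenvectorUnitary
  rw [Unitary.coe_star, e1] at h1
  rw [e1] at h2
  refine ⟨_, hH.eigenvalues, h1, h2, fun a => ?_⟩
  induction a with
  | zero => simp [h1]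
  | succ a ih =>
    have hs : W = (hH.eigenvectorUnitary : Matrix d d ℝ) * diagonal hH.eigenvalues *
        (hH.eigenvectorUnitary : Matrix d d ℝ)ᵀ := by
      have := hH.spectral_theorem
      rw [Unitary.conjStarAlgAut_apply, ← e1] at *
      exact this
    generalize (hH.eigenvectorUnitary : Matrix d d ℝ) = U at *
    calc W ^ (a + 1) = W ^ a * W := pow_succ _ _
      _ = (U * diagonal (fun j => hH.eigenvalues j ^ a) * Uᵀ) *
          (U * diagonal hH.eigenvalues * Uᵀ) := by rw [ih, ← hs]
      _ = U * diagonal (fun j => hH.eigenvalues j ^ a) * (Uᵀ * U) *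
          diagonal hH.eigenvalues * Uᵀ := by simp only [Matrix.mul_assoc]
      _ = _ := by
        rw [h2, Matrix.mul_one, Matrix.mul_assoc U, diagonal_mul_diagonal]
        simp only [pow_succ]

/-- In eigenbases `U` of `W` and `V` of `Y` the trace has the squared entries of `Uᵀ H V` as
coefficients. Their nonnegativity reduces noncommutative trace inequalities to scalar inequalities
between eigenvalues. -/
lemma exists_trace_formula {W Y H : Matrix d d ℝ} (hW : Wᵀ = W) (hY : Yᵀ = Y) (hH : Hᵀ = H) :
    ∃ (w y : d → ℝ) (c : d → d → ℝ), (∀ j k, 0 ≤ c j k) ∧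
      ∀ a b : ℕ, trace (H * W ^ a * H * Y ^ b) = ∑ k, ∑ j, c j k * (w j ^ a * y k ^ b) := by
  obtain ⟨U, w, -, -, hw⟩ := exists_diagonalization hW
  obtain ⟨V, y, -, -, hy⟩ := exists_diagonalization hY
  refine ⟨w, y, fun j k => (Uᵀ * H * V) j k ^ 2, fun _ _ => sq_nonneg _, fun a b => ?_⟩
  have hN : (Uᵀ * H * V)ᵀ = Vᵀ * H * U := by
    simp [transpose_mul, hH, Matrix.mul_assoc]
  have : trace (H * W ^ a * H * Y ^ b) =
      trace ((Uᵀ * H * V)ᵀ * diagonal (fun j => w j ^ a) * (Uᵀ * H * V) *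
        diagonal (fun j => y j ^ b)) := by
    rw [hw, hy, hN]
    rw [show H * (U * diagonal (fun j => w j ^ a) * Uᵀ) * H *
      (V * diagonal (fun j => y j ^ b) * Vᵀ) = (H * U * diagonal (fun j => w j ^ a) * Uᵀ * H *
      V * diagonal (fun j => y j ^ b)) * Vᵀ by simp only [Matrix.mul_assoc], trace_mul_comm]
    simp only [Matrix.mul_assoc]
  rw [this]
  generalize Uᵀ * H * V = N
  simp only [trace, diag_apply, mul_diagonal]
  refine Finset.sum_congr rfl fun k _ => ?_
  rw [Matrix.mul_apply, Finset.sum_mul]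
  refine Finset.sum_congr rfl fun j _ => ?_
  rw [mul_diagonal, transpose_apply]
  ring

/-- The differences `|w|^q - |y|^q` and `|w|^s - |y|^s` have the same sign. Evenness of `q + s`
makes the right side insensitive to signs. -/
lemma mul_pow_add_mul_pow_le (w y : ℝ) (q s : ℕ) (h : Even (q + s)) :
    w ^ q * y ^ s + w ^ s * y ^ q ≤ w ^ (q + s) + y ^ (q + s) := by
  have key : 0 ≤ (|w| ^ q - |y| ^ q) * (|w| ^ s - |y| ^ s) := by
    rcases le_total |w| |y| with h | h
    · exact mul_nonneg_of_nonpos_of_nonpos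
        (sub_nonpos.2 (pow_le_pow_left₀ (abs_nonneg _) h _))
        (sub_nonpos.2 (pow_le_pow_left₀ (abs_nonneg _) h _))
    · exact mul_nonneg (sub_nonneg.2 (pow_le_pow_left₀ (abs_nonneg _) h _))
        (sub_nonneg.2 (pow_le_pow_left₀ (abs_nonneg _) h _))
  have e1 : w ^ (q + s) = |w| ^ q * |w| ^ s := by rw [← pow_add, h.pow_abs]
  have e2 : y ^ (q + s) = |y| ^ q * |y| ^ s := by rw [← pow_add, h.pow_abs]
  have a1 : w ^ q * y ^ s ≤ |w| ^ q * |y| ^ s := by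
    rw [← abs_pow, ← abs_pow, ← abs_mul]; exact le_abs_self _
  have a2 : w ^ s * y ^ q ≤ |w| ^ s * |y| ^ q := by
    rw [← abs_pow, ← abs_pow, ← abs_mul]; exact le_abs_self _
  rw [e1, e2]; nlinarith

/-- The trace inequality behind the exchange argument for matrix Rademacher series. -/
lemma trace_exchange_le {W Y H : Matrix d d ℝ} (hW : Wᵀ = W) (hY : Yᵀ = Y) (hH : Hᵀ = H)
    (r : ℕ) :
    ∑ q ∈ range (2 * r + 1), trace (H * W ^ q * H * Y ^ (2 * r - q)) ≤
      (2 * r + 1) / 2 * (trace (H * H * W ^ (2 * r)) + trace (H * H * Y ^ (2 * r))) := by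
  obtain ⟨w, y, c, hc, hf⟩ := exists_trace_formula hW hY hH
  have e1 : trace (H * H * W ^ (2 * r)) = trace (H * W ^ (2 * r) * H * Y ^ 0) := by
    rw [pow_zero, Matrix.mul_one, trace_mul_comm (H * W ^ (2 * r)), Matrix.mul_assoc]
  have e2 : trace (H * H * Y ^ (2 * r)) = trace (H * W ^ 0 * H * Y ^ (2 * r)) := by simp
  -- Pairing `q` with `2r - q` allows the scalar inequality for each pair of eigenvalues; summing
  -- over all `q` then counts every term twice, which is the factor 1/2 in the claim.
  have hpair : ∀ q ∈ range (2 * r + 1),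
      trace (H * W ^ q * H * Y ^ (2 * r - q)) +
        trace (H * W ^ (2 * r + 1 - 1 - q) * H * Y ^ (2 * r - (2 * r + 1 - 1 - q))) ≤
      trace (H * H * W ^ (2 * r)) + trace (H * H * Y ^ (2 * r)) := by
    intro q hq
    rw [mem_range] at hq
    rw [show 2 * r + 1 - 1 - q = 2 * r - q by omega, show 2 * r - (2 * r - q) = q by omega,
      e1, e2]
    simp only [hf, ← Finset.sum_add_distrib, ← mul_add]
    refine Finset.sum_le_sum fun k _ => Finset.sum_le_sum fun j _ =>
      mul_le_mul_of_nonneg_left ?_ (hc j k)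
    have := mul_pow_add_mul_pow_le (w j) (y k) q (2 * r - q)
      (by rw [show q + (2 * r - q) = 2 * r by omega]; exact even_two_mul r)
    rw [show q + (2 * r - q) = 2 * r by omega] at this
    simpa using this
  have h := Finset.sum_le_sum hpair
  rw [Finset.sum_add_distrib,
    Finset.sum_range_reflect (fun q => trace (H * W ^ q * H * Y ^ (2 * r - q))) (2 * r + 1)] at h
  rw [Finset.sum_const, card_range, nsmul_eq_mul] at h
  push_cast at h
  linarith

lemma pow_sub_pow_eq_sum {R : Type*} [Ring R] (x y : R) (k : ℕ) :
    x ^ k - y ^ k = ∑ q ∈ range k, x ^ q * (x - y) * y ^ (k - 1 - q) := by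
  induction k with
  | zero => simp
  | succ k ih =>
    rw [Finset.sum_range_succ]
    have : ∑ q ∈ range k, x ^ q * (x - y) * y ^ (k + 1 - 1 - q) =
        (x ^ k - y ^ k) * y := by
      rw [ih, Finset.sum_mul]
      refine Finset.sum_congr rfl fun q hq => ?_
      rw [mem_range] at hq
      rw [show k + 1 - 1 - q = (k - 1 - q) + 1 by omega, pow_succ, mul_assoc _ _ y]
    rw [this]
    simp only [Nat.add_sub_cancel, Nat.sub_self, pow_zero, mul_one, pow_succ]
    noncomm_ring

lemma transpose_pow_eq {W : Matrix d d ℝ} (hW : Wᵀ = W) (a : ℕ) : (W ^ a)ᵀ = W ^ a := by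
  rw [transpose_pow, hW]

/-- If `V ≤ v` in the Loewner order, then `tr (V X ^ (2 r)) ≤ v tr (X ^ (2 r))`. -/
lemma trace_mul_pow_le {V X : Matrix d d ℝ} (hX : Xᵀ = X) {v : ℝ}
    (hV : ∀ y : d → ℝ, y ⬝ᵥ (V *ᵥ y) ≤ v * (y ⬝ᵥ y)) (r : ℕ) :
    trace (V * X ^ (2 * r)) ≤ v * trace (X ^ (2 * r)) := by
  -- Since `X^(2r)` is the product of the symmetric `X^r` with itself, the trace is a sum of
  -- quadratic forms of `Z` at the columns of `X^r`; the case `Z = 1` gives the right side.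
  have e (Z : Matrix d d ℝ) : trace (Z * X ^ (2 * r)) =
      ∑ j, (fun i => (X ^ r) i j) ⬝ᵥ (Z *ᵥ fun i => (X ^ r) i j) := by
    rw [two_mul, pow_add, ← Matrix.mul_assoc, trace_mul_comm]
    conv_lhs => rw [← transpose_pow_eq hX r]
    rw [transpose_pow_eq hX r]
    simp only [trace, diag_apply]
    refine Finset.sum_congr rfl fun j _ => ?_
    rw [Matrix.mul_apply]
    refine Finset.sum_congr rfl fun i _ => ?_
    rw [Matrix.mul_apply, mulVec, dotProduct]
    congr 1
    exact (congrFun (congrFun (transpose_pow_eq hX r) i) j)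
  rw [e, ← Matrix.one_mul (X ^ (2 * r)), e, Finset.mul_sum]
  refine Finset.sum_le_sum fun j _ => ?_
  rw [Matrix.one_mulVec]
  exact hV _

lemma trace_pow_two_mul_nonneg {X : Matrix d d ℝ} (hX : Xᵀ = X) (r : ℕ) :
    0 ≤ trace (X ^ (2 * r)) := by
  obtain ⟨U, w, -, hU, hw⟩ := exists_diagonalization hX
  rw [hw, Matrix.mul_assoc, trace_mul_comm, Matrix.mul_assoc, hU, Matrix.mul_one, trace_diagonal]
  exact Finset.sum_nonneg fun j _ => (even_two_mul r).pow_nonneg _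

/-- A bound on the trace of an even power is a bound on the operator norm. -/
lemma mulVec_le_of_trace_pow_le {X : Matrix d d ℝ} (hX : Xᵀ = X) {p : ℕ} (hp : p ≠ 0) {s : ℝ}
    (hs : 0 ≤ s) (h : trace (X ^ (2 * p)) ≤ s ^ p) (y : d → ℝ) :
    (X *ᵥ y) ⬝ᵥ (X *ᵥ y) ≤ s * (y ⬝ᵥ y) := by
  obtain ⟨U, w, hU', hU, hw⟩ := exists_diagonalization hX
  rw [hw, Matrix.mul_assoc, trace_mul_comm, Matrix.mul_assoc, hU, Matrix.mul_one,
    trace_diagonal] at h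
  -- The trace is the sum of the nonnegative numbers `w j ^ (2p)`, so it dominates each of them.
  have hle : ∀ j, w j ^ 2 ≤ s := by
    intro j
    have h1 : (w j ^ 2) ^ p ≤ s ^ p := by
      rw [← pow_mul]
      exact (Finset.single_le_sum (f := fun j => w j ^ (2 * p))
        (fun i _ => (even_two_mul p).pow_nonneg _) (mem_univ j)).trans h
    exact (pow_le_pow_iff_left₀ (sq_nonneg _) hs hp).1 h1
  have e1 : (X *ᵥ y) ⬝ᵥ (X *ᵥ y) = (Uᵀ *ᵥ y) ⬝ᵥ (diagonal (fun j => w j ^ 2) *ᵥ (Uᵀ *ᵥ y)) := by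
    rw [dotProduct_mulVec, ← mulVec_transpose, hX, dotProduct_comm, mulVec_mulVec, ← sq, hw,
      ← mulVec_mulVec, ← mulVec_mulVec, dotProduct_mulVec, ← mulVec_transpose]
  have e2 : y ⬝ᵥ y = (Uᵀ *ᵥ y) ⬝ᵥ (Uᵀ *ᵥ y) := by
    rw [dotProduct_mulVec, ← mulVec_transpose, transpose_transpose, mulVec_mulVec, hU', one_mulVec]
  rw [e1, e2, dotProduct, dotProduct, Finset.mul_sum]
  refine Finset.sum_le_sum fun j _ => ?_
  rw [mulVec_diagonal]
  nlinarith [mul_le_mul_of_nonneg_right (hle j) (mul_self_nonneg ((Uᵀ *ᵥ y) j))]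

end Spectral

/-! ### Noncommutative Khintchine inequality by flipping one sign -/

/-- The sign of a coin. -/
def sgn (b : Bool) : ℝ := if b then 1 else -1

lemma sgn_mul_self (b : Bool) : sgn b * sgn b = 1 := by cases b <;> norm_num [sgn]

lemma sgn_not (b : Bool) : sgn (!b) = -sgn b := by cases b <;> simp [sgn]

section Rademacher
variable {d ι : Type} [Fintype ι]

/-- The Rademacher sum of the matrices `A i` with the signs `σ`. -/
def signSum (A : ι → Matrix d d ℝ) (σ : ι → Bool) : Matrix d d ℝ := ∑ i, sgn (σ i) • A i

lemma signSum_transpose {A : ι → Matrix d d ℝ} (hA : ∀ i, (A i)ᵀ = A i) (σ : ι → Bool) :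
    (signSum A σ)ᵀ = signSum A σ := by
  simp [signSum, transpose_sum, hA]

variable [DecidableEq ι]

/-- Flips one sign. -/
def flipSign {ι : Type} [DecidableEq ι] (i : ι) (σ : ι → Bool) : ι → Bool := Function.update σ i (!σ i)

lemma flipSign_involutive {ι : Type} [DecidableEq ι] (i : ι) : Function.Involutive (flipSign i) := fun σ => by
  simp [flipSign]

lemma sum_flipSign (i : ι) (f : (ι → Bool) → ℝ) : ∑ σ, f (flipSign i σ) = ∑ σ, f σ :=
  (Equiv.sum_comp (flipSign_involutive i).toPerm f)

lemma signSum_sub_flipSign (A : ι → Matrix d d ℝ) (σ : ι → Bool) (i : ι) :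
    signSum A σ - signSum A (flipSign i σ) = (2 * sgn (σ i)) • A i := by
  rw [signSum, signSum, ← Finset.sum_sub_distrib, Finset.sum_eq_single i]
  · rw [flipSign, Function.update_self, sgn_not, ← sub_smul]; congr 1; ring
  · intro j _ hj
    rw [flipSign, Function.update_of_ne hj, sub_self]
  · simp

variable [Fintype d] [DecidableEq d]

/-- Splitting off one factor of the power gives terms `± tr (A i * S^(2r+1))`. Averaging such a term
with its value after flipping the sign `i` leaves a difference of odd powers of two sums that differ
by `± 2 A i`. Telescoping and `trace_exchange_le` bound it by traces of `A i * A i * S^(2r)`, and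
the matrix variance `∑ A i * A i` is at most `v`. -/
lemma sum_trace_pow_succ_le {A : ι → Matrix d d ℝ} (hA : ∀ i, (A i)ᵀ = A i) {v : ℝ}
    (hv : ∀ y : d → ℝ, ∑ i, (A i *ᵥ y) ⬝ᵥ (A i *ᵥ y) ≤ v * (y ⬝ᵥ y)) (r : ℕ) :
    ∑ σ, trace (signSum A σ ^ (2 * (r + 1))) ≤
      (2 * r + 1) * v * ∑ σ, trace (signSum A σ ^ (2 * r)) := by
  have hS := signSum_transpose hA
  have step (i : ι) : ∑ σ, sgn (σ i) * trace (A i * signSum A σ ^ (2 * r + 1)) ≤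
      (2 * r + 1) * ∑ σ, trace (A i * A i * signSum A σ ^ (2 * r)) := by
    have hflip : 2 * ∑ σ, sgn (σ i) * trace (A i * signSum A σ ^ (2 * r + 1)) =
        ∑ σ, (sgn (σ i) * trace (A i * signSum A σ ^ (2 * r + 1)) +
          sgn (flipSign i σ i) * trace (A i * signSum A (flipSign i σ) ^ (2 * r + 1))) := by
      rw [Finset.sum_add_distrib,
        sum_flipSign i fun σ => sgn (σ i) * trace (A i * signSum A σ ^ (2 * r + 1)), two_mul]
    have hterm (σ : ι → Bool) : sgn (σ i) * trace (A i * signSum A σ ^ (2 * r + 1)) +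
          sgn (flipSign i σ i) * trace (A i * signSum A (flipSign i σ) ^ (2 * r + 1)) ≤
        (2 * r + 1) * (trace (A i * A i * signSum A σ ^ (2 * r)) +
          trace (A i * A i * signSum A (flipSign i σ) ^ (2 * r))) := by
      -- Each telescoped summand contains one more factor `2 sgn (σ i) • A i`; the two signs cancel,
      -- leaving a sum without signs.
      have e : sgn (σ i) * trace (A i * signSum A σ ^ (2 * r + 1)) +
          sgn (flipSign i σ i) * trace (A i * signSum A (flipSign i σ) ^ (2 * r + 1)) =
          2 * ∑ q ∈ range (2 * r + 1),
            trace (A i * signSum A σ ^ q * A i * signSum A (flipSign i σ) ^ (2 * r - q)) := by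
        rw [flipSign, Function.update_self, sgn_not, ← flipSign, neg_mul, ← sub_eq_add_neg,
          ← mul_sub, ← trace_sub, ← Matrix.mul_sub, pow_sub_pow_eq_sum, signSum_sub_flipSign,
          Finset.mul_sum, trace_sum, Finset.mul_sum, Finset.mul_sum]
        refine Finset.sum_congr rfl fun q _ => ?_
        rw [Nat.add_sub_cancel, Matrix.mul_smul, Matrix.smul_mul, Matrix.mul_smul, trace_smul,
          smul_eq_mul, ← mul_assoc, mul_left_comm, sgn_mul_self, mul_one]
        simp only [Matrix.mul_assoc]
      rw [e]
      have := trace_exchange_le (hS σ) (hS (flipSign i σ)) (hA i) r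
      linarith
    have h := Finset.sum_le_sum fun σ (_ : σ ∈ univ) => hterm σ
    rw [← hflip, ← Finset.mul_sum, Finset.sum_add_distrib,
      sum_flipSign i fun σ => trace (A i * A i * signSum A σ ^ (2 * r))] at h
    linarith
  have hV : ∀ y : d → ℝ, y ⬝ᵥ ((∑ i, A i * A i) *ᵥ y) ≤ v * (y ⬝ᵥ y) := by
    intro y
    refine le_trans (le_of_eq ?_) (hv y)
    rw [Matrix.sum_mulVec, dotProduct_sum]
    refine Finset.sum_congr rfl fun i _ => ?_
    rw [← mulVec_mulVec, dotProduct_mulVec, ← mulVec_transpose, hA]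
  calc ∑ σ, trace (signSum A σ ^ (2 * (r + 1)))
      = ∑ i, ∑ σ, sgn (σ i) * trace (A i * signSum A σ ^ (2 * r + 1)) := by
        rw [Finset.sum_comm]
        refine Finset.sum_congr rfl fun σ _ => ?_
        rw [show 2 * (r + 1) = (2 * r + 1) + 1 by ring, pow_succ']
        nth_rw 1 [signSum]
        rw [Finset.sum_mul, trace_sum]
        refine Finset.sum_congr rfl fun i _ => ?_
        rw [Matrix.smul_mul, trace_smul, smul_eq_mul]
    _ ≤ ∑ i, (2 * r + 1) * ∑ σ, trace (A i * A i * signSum A σ ^ (2 * r)) :=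
        Finset.sum_le_sum fun i _ => step i
    _ = (2 * r + 1) * ∑ σ, trace ((∑ i, A i * A i) * signSum A σ ^ (2 * r)) := by
        rw [← Finset.mul_sum, Finset.sum_comm]
        simp only [Finset.sum_mul, trace_sum]
    _ ≤ (2 * r + 1) * ∑ σ, v * trace (signSum A σ ^ (2 * r)) := by
        refine mul_le_mul_of_nonneg_left (Finset.sum_le_sum fun σ _ => ?_) (by positivity)
        exact trace_mul_pow_le (hS σ) hV r
    _ = _ := by rw [← Finset.mul_sum, mul_assoc]

/-- The moment form of the noncommutative Khintchine inequality. -/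
lemma sum_trace_pow_le {A : ι → Matrix d d ℝ} (hA : ∀ i, (A i)ᵀ = A i) {v : ℝ} (hv0 : 0 ≤ v)
    (hv : ∀ y : d → ℝ, ∑ i, (A i *ᵥ y) ⬝ᵥ (A i *ᵥ y) ≤ v * (y ⬝ᵥ y)) {p r : ℕ} (hr : r ≤ p) :
    ∑ σ, trace (signSum A σ ^ (2 * r)) ≤
      (2 * p * v) ^ r * (Fintype.card d * 2 ^ Fintype.card ι) := by
  induction r with
  | zero => simp [trace_one, mul_comm]
  | succ r ih =>
    have h0 : 0 ≤ ∑ σ, trace (signSum A σ ^ (2 * r)) :=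
      Finset.sum_nonneg fun σ _ => trace_pow_two_mul_nonneg (signSum_transpose hA σ) r
    -- The odd factors of the recursion are all replaced by `2p`, so that the bound is a pure power.
    have hrp : (2 * (r : ℝ) + 1) ≤ 2 * p := by exact_mod_cast (by omega : 2 * r + 1 ≤ 2 * p)
    calc _ ≤ (2 * r + 1) * v * ∑ σ, trace (signSum A σ ^ (2 * r)) := sum_trace_pow_succ_le hA hv r
      _ ≤ (2 * p * v) * ((2 * p * v) ^ r * (Fintype.card d * 2 ^ Fintype.card ι)) :=
        mul_le_mul (mul_le_mul_of_nonneg_right hrp hv0) (ih (by omega)) h0 (by positivity)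
      _ = _ := by rw [pow_succ]; ring

open Classical in
/-- The tail form of the noncommutative Khintchine inequality, for symmetric matrices. -/
lemma card_signSum_large_le {A : ι → Matrix d d ℝ} (hA : ∀ i, (A i)ᵀ = A i) {v : ℝ} (hv0 : 0 < v)
    (hv : ∀ y : d → ℝ, ∑ i, (A i *ᵥ y) ⬝ᵥ (A i *ᵥ y) ≤ v * (y ⬝ᵥ y)) {p : ℕ} (hp : p ≠ 0) :
    ((univ.filter fun σ : ι → Bool => ¬ ∀ y : d → ℝ,
        (signSum A σ *ᵥ y) ⬝ᵥ (signSum A σ *ᵥ y) ≤ 4 * p * v * (y ⬝ᵥ y)).card : ℝ) ≤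
      Fintype.card d * (1 / 2) ^ p * 2 ^ Fintype.card ι := by
  set Bad := univ.filter fun σ : ι → Bool => ¬ ∀ y : d → ℝ,
        (signSum A σ *ᵥ y) ⬝ᵥ (signSum A σ *ᵥ y) ≤ 4 * p * v * (y ⬝ᵥ y)
  have hp0 : (0 : ℝ) < p := by exact_mod_cast Nat.pos_of_ne_zero hp
  -- Markov's inequality for the `2p`-th moment. The threshold `4pv` is twice the base `2pv` of the
  -- moment bound, which produces the factor `(1/2)^p`.
  have h1 : Bad.card * (4 * p * v) ^ p ≤
      (2 * p * v) ^ p * (Fintype.card d * 2 ^ Fintype.card ι) := by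
    refine le_trans ?_ (sum_trace_pow_le hA hv0.le hv le_rfl)
    rw [← nsmul_eq_mul, ← Finset.sum_const]
    refine le_trans (Finset.sum_le_sum fun σ hσ => ?_) (Finset.sum_le_sum_of_subset_of_nonneg
      (Finset.subset_univ Bad) fun σ _ _ => trace_pow_two_mul_nonneg (signSum_transpose hA σ) p)
    by_contra hlt
    exact (mem_filter.1 hσ).2 (mulVec_le_of_trace_pow_le (signSum_transpose hA σ) hp
      (by positivity) (not_le.1 hlt).le)
  have h2 : (2 * p * v) ^ p = (1 / 2) ^ p * (4 * p * v) ^ p := by rw [← mul_pow]; congr 1; ring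
  rw [h2] at h1
  have h3 : 0 < (4 * p * v) ^ p := by positivity
  refine le_of_mul_le_mul_right (h1.trans (le_of_eq ?_)) h3
  ring

open Classical in
/-- The tail form of the noncommutative Khintchine inequality, for square matrices. -/
lemma card_signSum_large_le' {B : ι → Matrix d d ℝ} {v : ℝ} (hv0 : 0 < v)
    (hv : ∀ y : d → ℝ, ∑ i, (B i *ᵥ y) ⬝ᵥ (B i *ᵥ y) ≤ v * (y ⬝ᵥ y))
    (hv' : ∀ y : d → ℝ, ∑ i, ((B i)ᵀ *ᵥ y) ⬝ᵥ ((B i)ᵀ *ᵥ y) ≤ v * (y ⬝ᵥ y))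
    {p : ℕ} (hp : p ≠ 0) :
    ((univ.filter fun σ : ι → Bool => ¬ ∀ y : d → ℝ,
        (signSum B σ *ᵥ y) ⬝ᵥ (signSum B σ *ᵥ y) ≤ 4 * p * v * (y ⬝ᵥ y)).card : ℝ) ≤
      2 * Fintype.card d * (1 / 2) ^ p * 2 ^ Fintype.card ι := by
  -- Hermitian dilation: its square is block diagonal with blocks `B Bᵀ` and `Bᵀ B`, hence both
  -- variance hypotheses, and the doubled dimension gives the factor 2.
  let A : ι → Matrix (d ⊕ d) (d ⊕ d) ℝ := fun i => fromBlocks 0 (B i) (B i)ᵀ 0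
  have hA : ∀ i, (A i)ᵀ = A i := fun i => by simp [A, fromBlocks_transpose]
  have hs (σ : ι → Bool) : signSum A σ = fromBlocks 0 (signSum B σ) (signSum B σ)ᵀ 0 := by
    ext (i | i) (j | j) <;> simp [signSum, A, Matrix.sum_apply]
  have hdot (f g f' g' : d → ℝ) : Sum.elim f g ⬝ᵥ Sum.elim f' g' = f ⬝ᵥ f' + g ⬝ᵥ g' := by
    simp [dotProduct]
  have h := card_signSum_large_le (A := A) hA hv0 (fun y => by
    rw [← Sum.elim_comp_inl_inr y]
    generalize y ∘ Sum.inl = f, y ∘ Sum.inr = g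
    simp only [A, fromBlocks_mulVec, hdot, zero_mulVec, zero_add, add_zero,
      Function.comp_def, Sum.elim_inl, Sum.elim_inr, Finset.sum_add_distrib]
    have := hv g; have := hv' f
    linarith) hp
  rw [Fintype.card_sum] at h
  push_cast at h
  refine le_trans ?_ (h.trans (le_of_eq (by ring)))
  norm_cast
  refine Finset.card_le_card fun σ hσ => ?_
  rw [mem_filter] at hσ ⊢
  refine ⟨mem_univ _, fun hall => hσ.2 fun y => ?_⟩
  have := hall (Sum.elim 0 y)
  rw [hs, fromBlocks_mulVec] at this
  have e1 : Sum.elim (0 : d → ℝ) y ∘ Sum.inl = 0 := rfl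
  have e2 : Sum.elim (0 : d → ℝ) y ∘ Sum.inr = y := rfl
  simpa [hdot, e1, e2] using this

open Classical in
/-- The scalar Khintchine inequality in tail form. -/
lemma card_sum_sgn_large_le {x : ι → ℝ} {v : ℝ} (hv0 : 0 < v) (hv : ∑ i, x i ^ 2 ≤ v)
    {p : ℕ} (hp : p ≠ 0) :
    ((univ.filter fun σ : ι → Bool =>
        ¬ (∑ i, sgn (σ i) * x i) ^ 2 ≤ 4 * p * v).card : ℝ) ≤
      (1 / 2) ^ p * 2 ^ Fintype.card ι := by
  let A : ι → Matrix Unit Unit ℝ := fun i => of fun _ _ => x i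
  have h := card_signSum_large_le (A := A) (fun i => rfl) hv0 (fun y => by
    simp only [A, mulVec, dotProduct, of_apply, univ_unique, sum_singleton, PUnit.default_eq_unit]
    rw [show ∑ i, x i * y () * (x i * y ()) = (∑ i, x i ^ 2) * (y () * y ()) by
      rw [Finset.sum_mul]; exact Finset.sum_congr rfl fun i _ => by ring]
    exact mul_le_mul_of_nonneg_right hv (mul_self_nonneg _)) hp
  rw [Fintype.card_unit, Nat.cast_one, one_mul] at h
  refine le_trans ?_ h
  norm_cast
  refine Finset.card_le_card fun σ hσ => ?_
  rw [mem_filter] at hσ ⊢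
  refine ⟨mem_univ _, fun hall => hσ.2 ?_⟩
  have := hall 1
  simpa [signSum, A, mulVec, dotProduct, Matrix.sum_apply, sq] using this

end Rademacher
end CycleSparsify
namespace CycleSparsify
open Matrix Finset

/-! ### Pseudoinverses -/

section Pinv
variable {n : ℕ} {A : Matrix (Fin n) (Fin n) ℝ}

/-- A matrix has finite spectrum, so every function is continuous on it and discontinuous ones such
as `x⁻¹` are admissible. -/
lemma cfc_mul_cfc (f g : ℝ → ℝ) : cfc f A * cfc g A = cfc (fun x => f x * g x) A :=
  (cfc_mul f g A (A.finite_real_spectrum.continuousOn f) (A.finite_real_spectrum.continuousOn g)).symm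

lemma cfc_transpose (f : ℝ → ℝ) : (cfc f A)ᵀ = cfc f A := by
  have : IsSelfAdjoint (cfc f A) := IsSelfAdjoint.cfc
  rw [isSelfAdjoint_iff, star_eq_conjTranspose, conjTranspose_eq_transpose_of_trivial] at this
  exact this

lemma cfc_id_eq (hA : Aᵀ = A) : cfc (fun x : ℝ => x) A = A := by
  refine cfc_id' ℝ A ?_
  rw [isSelfAdjoint_iff, star_eq_conjTranspose, conjTranspose_eq_transpose_of_trivial, hA]

lemma mul_pinv (hA : Aᵀ = A) : A * pinv A = cfc (fun x : ℝ => x * x⁻¹) A := by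
  conv_lhs => arg 1; rw [← cfc_id_eq hA]
  rw [pinv, cfc_mul_cfc]

lemma mul_pinv_mul (hA : Aᵀ = A) : A * pinv A * A = A := by
  rw [mul_pinv hA]
  conv_lhs => arg 2; rw [← cfc_id_eq hA]
  rw [cfc_mul_cfc]
  conv_rhs => rw [← cfc_id_eq hA]
  congr 1; ext x
  by_cases hx : x = 0 <;> simp [hx]

lemma pinvSqrt_transpose : (pinvSqrt A)ᵀ = pinvSqrt A := cfc_transpose _

lemma pinv_transpose : (pinv A)ᵀ = pinv A := cfc_transpose _

lemma pinvSqrt_mul_self (hA : A.PosSemidef) : pinvSqrt A * pinvSqrt A = pinv A := by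
  rw [pinvSqrt, cfc_mul_cfc, pinv]
  refine cfc_congr fun x hx => ?_
  have hx0 : 0 ≤ x := (posSemidef_iff_isHermitian_and_spectrum_nonneg.1 hA).2 hx
  show (√x)⁻¹ * (√x)⁻¹ = x⁻¹
  rw [← mul_inv, Real.mul_self_sqrt hx0]

/-- On nonnegative `x` both sides apply `x * x⁻¹`, the indicator of `x ≠ 0`. The normalized
Laplacian is therefore an orthogonal projection. -/
lemma pinvSqrt_mul_mul_pinvSqrt (hA : A.PosSemidef) :
    pinvSqrt A * A * pinvSqrt A = A * pinv A := by
  have hs : Aᵀ = A := by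
    rw [← conjTranspose_eq_transpose_of_trivial]; exact hA.isHermitian
  rw [mul_pinv hs]
  conv_lhs => arg 1; arg 2; rw [← cfc_id_eq hs]
  rw [pinvSqrt, cfc_mul_cfc, cfc_mul_cfc]
  refine cfc_congr fun x hx => ?_
  have hx0 : 0 ≤ x := (posSemidef_iff_isHermitian_and_spectrum_nonneg.1 hA).2 hx
  show (√x)⁻¹ * x * (√x)⁻¹ = x * x⁻¹
  rw [mul_comm _ x, mul_assoc, ← mul_inv, Real.mul_self_sqrt hx0]

lemma mul_pinv_transpose (hA : Aᵀ = A) : (A * pinv A)ᵀ = A * pinv A := by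
  rw [mul_pinv hA, cfc_transpose]

lemma mul_pinv_idem (hA : Aᵀ = A) : (A * pinv A) * (A * pinv A) = A * pinv A := by
  rw [← Matrix.mul_assoc, mul_pinv_mul hA]

/-- A symmetric idempotent matrix is at most the identity. -/
lemma dotProduct_mulVec_le_of_idem {d : Type} [Fintype d] {P : Matrix d d ℝ}
    (hP : Pᵀ = P) (h : P * P = P) (y : d → ℝ) : y ⬝ᵥ (P *ᵥ y) ≤ y ⬝ᵥ y := by
  have e : (P *ᵥ y) ⬝ᵥ (P *ᵥ y) = y ⬝ᵥ (P *ᵥ y) := by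
    rw [dotProduct_mulVec, ← mulVec_transpose, hP, mulVec_mulVec, h, dotProduct_comm]
  have h0 : 0 ≤ (y - P *ᵥ y) ⬝ᵥ (y - P *ᵥ y) := by
    rw [dotProduct]; exact Finset.sum_nonneg fun i _ => mul_self_nonneg _
  rw [sub_dotProduct, dotProduct_sub, dotProduct_sub, e, dotProduct_comm (P *ᵥ y) y] at h0
  linarith

lemma trace_le_card_of_idem {d : Type} [Fintype d] [DecidableEq d] {P : Matrix d d ℝ}
    (hP : Pᵀ = P) (h : P * P = P) : trace P ≤ Fintype.card d := by
  have hi : ∀ i, P i i ≤ 1 := by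
    intro i
    have := dotProduct_mulVec_le_of_idem hP h (Pi.single i 1)
    simpa using this
  calc trace P ≤ ∑ _i : d, (1 : ℝ) := Finset.sum_le_sum fun i _ => hi i
    _ = _ := by simp

end Pinv

/-! ### Laplacians as sums over the arcs -/

section Laplacian
variable {n : ℕ}

/-- The signed incidence vector of an edge. -/
def edgeVec (u v : Fin n) : Fin n → ℝ := Pi.single u 1 - Pi.single v 1

/-- The contribution of an arc to the directed Laplacian. -/
def arcLap (e : Arc n) : Matrix (Fin n) (Fin n) ℝ :=
  (e.weight : ℝ) • vecMulVec (edgeVec e.tail e.head) (Pi.single e.tail 1)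

/-- The contribution of an arc to the out-degrees minus the in-degrees. -/
def arcFlow (e : Arc n) : Fin n → ℝ := (e.weight : ℝ) • edgeVec e.tail e.head

lemma edgeVec_dotProduct (u v : Fin n) (p : Fin n → ℝ) : edgeVec u v ⬝ᵥ p = p u - p v := by
  simp [edgeVec, sub_dotProduct]

lemma outDeg_cons (e : Arc n) (G : DiGraph n) (u : Fin n) :
    outDeg (e :: G) u = (if e.tail = u then e.weight else 0) + outDeg G u := by
  by_cases h : e.tail = u <;> simp [outDeg, h]

lemma inDeg_cons (e : Arc n) (G : DiGraph n) (u : Fin n) :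
    inDeg (e :: G) u = (if e.head = u then e.weight else 0) + inDeg G u := by
  by_cases h : e.head = u <;> simp [inDeg, h]

lemma adjMatrix_cons (e : Arc n) (G : DiGraph n) (u v : Fin n) :
    adjMatrix (e :: G) u v =
      (if e.tail = u ∧ e.head = v then (e.weight : ℝ) else 0) + adjMatrix G u v := by
  by_cases h : e.tail = u ∧ e.head = v
  · simp [adjMatrix, List.filter_cons, h]
  · simp only [adjMatrix, List.filter_cons, h, of_apply, decide_false, if_false]
    simp

lemma dirLaplacian_eq_sum (G : DiGraph n) : dirLaplacian G = (G.map arcLap).sum := by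
  induction G with
  | nil =>
    ext u v
    simp [dirLaplacian, outDeg, adjMatrix]
  | cons e G ih =>
    rw [List.map_cons, List.sum_cons, ← ih]
    ext u v
    simp only [dirLaplacian, Matrix.sub_apply, Matrix.add_apply, diagonal_apply, transpose_apply,
      adjMatrix_cons, outDeg_cons, arcLap, Matrix.smul_apply, vecMulVec_apply, edgeVec,
      Pi.sub_apply, Pi.single_apply, smul_eq_mul]
    rcases eq_or_ne e.tail v with rfl | h1
    · by_cases h2 : u = e.tail
      · subst h2
        by_cases h3 : e.head = e.tail
        · simp [h3]
        · simp [h3, Ne.symm h3]; ring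
      · rcases eq_or_ne u e.head with rfl | h3
        · simp [h2]; ring
        · simp [h2, h3, Ne.symm h3]
    · simp only [h1, Ne.symm h1, if_false, false_and, mul_zero, zero_add]
      by_cases h2 : u = v
      · subst h2; simp [h1]
      · simp [h2]

lemma outDeg_sub_inDeg (G : DiGraph n) (u : Fin n) :
    (outDeg G u : ℝ) - inDeg G u = (G.map arcFlow).sum u := by
  induction G with
  | nil => simp [outDeg, inDeg]
  | cons e G ih =>
    rw [List.map_cons, List.sum_cons, Pi.add_apply, ← ih, outDeg_cons, inDeg_cons]
    simp only [arcFlow, edgeVec, Pi.smul_apply, Pi.sub_apply, Pi.single_apply, smul_eq_mul,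
      eq_comm (a := u)]
    push_cast
    split_ifs <;> ring

/-- Turns a condition at every vertex into the vanishing of a quantity that is additive over the
arcs. -/
lemma isEulerian_iff {G : DiGraph n} : IsEulerian G ↔ (G.map arcFlow).sum = 0 := by
  rw [funext_iff]
  refine forall_congr' fun u => ?_
  rw [← outDeg_sub_inDeg, Pi.zero_apply, sub_eq_zero, eq_comm]
  norm_cast

/-- Symmetrizing an arc yields the undirected edge matrix up to a diagonal term, and that diagonal
term is the flow of the arc, which cancels in balanced sums. -/
lemma vecMulVec_edge_add_transpose (u v : Fin n) :
    vecMulVec (edgeVec u v) (Pi.single u (1 : ℝ)) + (vecMulVec (edgeVec u v) (Pi.single u 1))ᵀ =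
      vecMulVec (edgeVec u v) (edgeVec u v) + diagonal (edgeVec u v) := by
  ext i j
  simp only [Matrix.add_apply, transpose_apply, vecMulVec_apply, edgeVec, diagonal_apply,
    Pi.sub_apply, Pi.single_apply]
  split_ifs <;> simp_all

lemma arcLap_add_transpose (e : Arc n) :
    arcLap e + (arcLap e)ᵀ =
      (e.weight : ℝ) • vecMulVec (edgeVec e.tail e.head) (edgeVec e.tail e.head) +
        diagonal (arcFlow e) := by
  rw [arcLap, transpose_smul, ← smul_add, vecMulVec_edge_add_transpose, smul_add, arcFlow,
    diagonal_smul]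

lemma undirLaplacian_eq_sum {G : DiGraph n} (hG : IsEulerian G) :
    undirLaplacian G = (1 / 2 : ℝ) • (G.map fun e => (e.weight : ℝ) •
      vecMulVec (edgeVec e.tail e.head) (edgeVec e.tail e.head)).sum := by
  have h : ∀ G : DiGraph n, (G.map arcLap).sum + ((G.map arcLap).sum)ᵀ =
      (G.map fun e => (e.weight : ℝ) •
        vecMulVec (edgeVec e.tail e.head) (edgeVec e.tail e.head)).sum +
      diagonal (G.map arcFlow).sum := by
    intro G
    induction G with
    | nil => simp
    | cons e G ih =>
      simp only [List.map_cons, List.sum_cons, transpose_add]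
      have hd : diagonal (arcFlow e + (G.map arcFlow).sum) =
          diagonal (arcFlow e) + diagonal (G.map arcFlow).sum := (diagonal_add _ _).symm
      rw [hd, add_add_add_comm, ih, arcLap_add_transpose]
      exact add_add_add_comm _ _ _ _
  rw [undirLaplacian, dirLaplacian_eq_sum, h, isEulerian_iff.1 hG]
  simp

lemma undirLaplacian_transpose (G : DiGraph n) : (undirLaplacian G)ᵀ = undirLaplacian G := by
  rw [undirLaplacian, transpose_smul, transpose_add, transpose_transpose, add_comm]

lemma undirLaplacian_mulVec {G : DiGraph n} (hG : IsEulerian G) (p : Fin n → ℝ) :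
    undirLaplacian G *ᵥ p = (1 / 2 : ℝ) • (G.map fun e =>
      ((e.weight : ℝ) * (p e.tail - p e.head)) • edgeVec e.tail e.head).sum := by
  rw [undirLaplacian_eq_sum hG, smul_mulVec]
  congr 1
  generalize (G : List (Arc n)) = l
  induction l with
  | nil => simp
  | cons e l ih =>
    simp only [List.map_cons, List.sum_cons]
    rw [add_mulVec, ih, smul_mulVec, vecMulVec_mulVec, edgeVec_dotProduct]
    congr 1
    ext i; simp; ring

lemma dotProduct_undirLaplacian {G : DiGraph n} (hG : IsEulerian G) (y p : Fin n → ℝ) :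
    y ⬝ᵥ (undirLaplacian G *ᵥ p) = (1 / 2 : ℝ) * (G.map fun e =>
      (e.weight : ℝ) * ((y e.tail - y e.head) * (p e.tail - p e.head))).sum := by
  rw [undirLaplacian_mulVec hG, dotProduct_smul, smul_eq_mul]
  congr 1
  generalize (G : List (Arc n)) = l
  induction l with
  | nil => simp
  | cons e l ih =>
    simp only [List.map_cons, List.sum_cons]
    rw [dotProduct_add, ih, dotProduct_smul, dotProduct_comm, edgeVec_dotProduct, smul_eq_mul]
    ring

lemma undirLaplacian_posSemidef {G : DiGraph n} (hG : IsEulerian G) :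
    (undirLaplacian G).PosSemidef := by
  refine PosSemidef.of_dotProduct_mulVec_nonneg ?_ fun y => ?_
  · rw [IsHermitian, conjTranspose_eq_transpose_of_trivial, undirLaplacian_transpose]
  · rw [star_trivial, dotProduct_undirLaplacian hG]
    refine mul_nonneg (by norm_num) (List.sum_nonneg ?_)
    simp only [List.mem_map]
    rintro x ⟨e, -, rfl⟩
    exact mul_nonneg (Nat.cast_nonneg _) (mul_self_nonneg _)

end Laplacian

/-! ### Effective resistances -/

section EffRes
variable {n : ℕ} {G : DiGraph n}

lemma list_sum_eq_zero_of_nonpos {α : Type} {l : List α} {f : α → ℝ} (h : ∀ x ∈ l, f x ≤ 0)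
    (hs : 0 ≤ (l.map f).sum) : ∀ x ∈ l, f x = 0 := by
  induction l with
  | nil => simp
  | cons a l ih =>
    rw [List.map_cons, List.sum_cons] at hs
    have h1 : f a ≤ 0 := h a (by simp)
    have h2 : (l.map f).sum ≤ 0 := by
      have := List.sum_le_card_nsmul (l.map f) 0 (by
        simp only [List.mem_map]
        rintro x ⟨e, he, rfl⟩
        exact h e (List.mem_cons_of_mem _ he))
      simpa using this
    intro x hx
    rcases List.mem_cons.1 hx with rfl | hx
    · linarith
    · exact ih (fun x hx => h x (List.mem_cons_of_mem _ hx)) (by linarith) x hx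

/-- The minimum principle: a potential that is superharmonic outside `v` is minimal at `v`. -/
lemma minimum_principle (hE : IsEulerian G) (hC : StronglyConnected G)
    (hw : ∀ e ∈ G, 0 < e.weight) {p : Fin n → ℝ} {v : Fin n}
    (hp : ∀ x, x ≠ v → 0 ≤ (undirLaplacian G *ᵥ p) x) (y : Fin n) : p v ≤ p y := by
  obtain ⟨x₀, -, hx₀⟩ := Finset.exists_min_image univ p ⟨v, mem_univ v⟩
  have hmin : ∀ z, p x₀ ≤ p z := fun z => hx₀ z (mem_univ z)
  -- The two disjuncts coincide because this is the endpoint `z = v` of the invariant below: along a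
  -- directed path from a minimizer, either the current vertex is a minimizer or `v` is already
  -- known to be one.
  suffices h : p v = p x₀ ∨ p v = p x₀ by rw [h.elim id id]; exact hmin y
  have key : ∀ z, Relation.ReflTransGen (fun x y => ∃ e ∈ G, e.tail = x ∧ e.head = y) x₀ z →
      p z = p x₀ ∨ p v = p x₀ := by
    intro z hz
    induction hz with
    | refl => exact Or.inl rfl
    | tail _ hstep ih =>
      obtain ⟨e, he, rfl, rfl⟩ := hstep
      rcases ih with ih | ih
      · by_cases hv : e.tail = v
        · exact Or.inr (hv ▸ ih)
        · left
          have h0 := hp e.tail hv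
          have hsum : (undirLaplacian G *ᵥ p) e.tail = (1 / 2 : ℝ) * (G.map fun e' =>
              ((e'.weight : ℝ) * (p e'.tail - p e'.head)) *
                edgeVec e'.tail e'.head e.tail).sum := by
            rw [undirLaplacian_mulVec hE, Pi.smul_apply, smul_eq_mul]
            congr 1
            generalize (G : List (Arc n)) = l
            induction l with
            | nil => simp
            | cons e l ih => simp [ih]
          rw [hsum] at h0
          -- At a minimizer every term of the Laplacian is nonpositive, while their sum is
          -- nonnegative; so all vanish, and the head of `e` has the same potential as its tail.
          have hz := list_sum_eq_zero_of_nonpos (f := fun e' : Arc n =>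
              ((e'.weight : ℝ) * (p e'.tail - p e'.head)) * edgeVec e'.tail e'.head e.tail)
            (fun e' _ => by
              have hw0 : (0 : ℝ) ≤ e'.weight := Nat.cast_nonneg _
              have h3 := hmin e'.tail
              have h4 := hmin e'.head
              simp only [edgeVec, Pi.sub_apply, Pi.single_apply]
              by_cases h1 : e.tail = e'.tail <;> by_cases h2 : e.tail = e'.head
              · simp [← h1, ← h2]
              · simp only [← h1, ih] at *
                simp only [h2, if_true, if_false]
                nlinarith
              · simp only [← h2, ih] at *
                simp only [h1, if_true, if_false]
                nlinarith
              · simp [h1, h2]) (by linarith) e he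
          simp only [edgeVec, Pi.sub_apply, Pi.single_apply, if_true] at hz
          by_cases h2 : e.tail = e.head
          · rw [← h2]; exact ih
          · rw [if_neg h2, sub_zero, mul_one] at hz
            have := (mul_eq_zero.1 hz).resolve_left (by exact_mod_cast (hw e he).ne')
            linarith
      · exact Or.inr ih
  exact key v (hC x₀ v)

/-- The Laplacian of a connected graph is invertible on the vectors orthogonal to the constants. -/
lemma undirLaplacian_mulVec_pinv (hE : IsEulerian G) (hC : StronglyConnected G)
    (hw : ∀ e ∈ G, 0 < e.weight) (u v : Fin n) :
    undirLaplacian G *ᵥ (pinv (undirLaplacian G) *ᵥ edgeVec u v) = edgeVec u v := by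
  have hs := undirLaplacian_transpose G
  set Lap := undirLaplacian G with hLap
  -- The minimum principle applies to a kernel vector with either vertex as the exceptional one.
  have hconst : ∀ y, Lap *ᵥ y = 0 → y u = y v := by
    intro y hy
    have h0 : ∀ x, 0 ≤ (Lap *ᵥ y) x := fun x => by rw [hy]; exact le_rfl
    exact le_antisymm (minimum_principle hE hC hw (fun x _ => h0 x) v)
      (minimum_principle hE hC hw (fun x _ => h0 x) u)
  have hQ : Lap * (1 - Lap * pinv Lap) = 0 := by
    have : pinv Lap * Lap = Lap * pinv Lap := by
      rw [← mul_pinv_transpose hs, transpose_mul, hs, pinv_transpose]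
    rw [Matrix.mul_sub, Matrix.mul_one, ← this, ← Matrix.mul_assoc, mul_pinv_mul hs, sub_self]
  have hQt : (1 - Lap * pinv Lap)ᵀ = 1 - Lap * pinv Lap := by
    rw [transpose_sub, transpose_one, mul_pinv_transpose hs]
  -- The columns of the complementary projection lie in the kernel, so their values at `u` and `v`
  -- agree and `edgeVec u v` is orthogonal to them.
  have hz : (1 - Lap * pinv Lap) *ᵥ edgeVec u v = 0 := by
    ext i
    have h1 : ((1 - Lap * pinv Lap) *ᵥ edgeVec u v) i =
        edgeVec u v ⬝ᵥ ((1 - Lap * pinv Lap) *ᵥ Pi.single i 1) := by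
      rw [dotProduct_mulVec, ← mulVec_transpose, hQt, dotProduct_single, mul_one]
    have h2 := hconst ((1 - Lap * pinv Lap) *ᵥ Pi.single i 1)
      (by rw [mulVec_mulVec, hQ, zero_mulVec])
    rw [h1, edgeVec_dotProduct, h2, sub_self]
    rfl
  rw [sub_mulVec, one_mulVec, sub_eq_zero] at hz
  rw [mulVec_mulVec, ← hz]

lemma effRes_eq (u v : Fin n) :
    effRes G u v = edgeVec u v ⬝ᵥ (pinv (undirLaplacian G) *ᵥ edgeVec u v) := rfl

lemma effRes_eq_pinvSqrt (hE : IsEulerian G) (u v : Fin n) :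
    effRes G u v = (pinvSqrt (undirLaplacian G) *ᵥ edgeVec u v) ⬝ᵥ
      (pinvSqrt (undirLaplacian G) *ᵥ edgeVec u v) := by
  rw [effRes_eq, ← pinvSqrt_mul_self (undirLaplacian_posSemidef hE), ← mulVec_mulVec,
    dotProduct_mulVec (edgeVec u v), ← mulVec_transpose, pinvSqrt_transpose]

lemma effRes_self (u : Fin n) : effRes G u u = 0 := by
  simp [effRes_eq, edgeVec]

lemma edgeVec_swap (u v : Fin n) : edgeVec v u = -edgeVec u v := by simp [edgeVec]

lemma effRes_comm (u v : Fin n) : effRes G u v = effRes G v u := by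
  rw [effRes_eq, effRes_eq, edgeVec_swap u v]
  simp [mulVec_neg]

/-- The effective resistance satisfies the triangle inequality. -/
lemma effRes_triangle (hE : IsEulerian G) (hC : StronglyConnected G)
    (hw : ∀ e ∈ G, 0 < e.weight) (u v x : Fin n) :
    effRes G u x ≤ effRes G u v + effRes G v x := by
  set p := pinv (undirLaplacian G) *ᵥ edgeVec u v with hp
  -- The potential of a unit current from `u` to `v` has Laplacian 1 at `u` and 0 at all other
  -- vertices outside `v` (0 throughout if `u = v`). Its minimality at `v` makes the cross terms in
  -- the expansion of `R(u, x)` nonpositive.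
  have hmin : p v ≤ p x := minimum_principle hE hC hw (fun z hz => by
    rw [hp, undirLaplacian_mulVec_pinv hE hC hw]
    simp only [edgeVec, Pi.sub_apply, Pi.single_apply, if_neg hz, sub_zero]
    split_ifs <;> norm_num) x
  have e : edgeVec u x = edgeVec u v + edgeVec v x := by simp [edgeVec]
  have hsym : edgeVec u v ⬝ᵥ (pinv (undirLaplacian G) *ᵥ edgeVec v x) = edgeVec v x ⬝ᵥ p := by
    rw [dotProduct_mulVec, ← mulVec_transpose, pinv_transpose, dotProduct_comm]
  have hneg : edgeVec v x ⬝ᵥ p ≤ 0 := by rw [edgeVec_dotProduct]; linarith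
  rw [effRes_eq, effRes_eq, effRes_eq, e, mulVec_add, add_dotProduct, dotProduct_add,
    dotProduct_add, hsym, ← hp]
  linarith

lemma effRes_nonneg (hE : IsEulerian G) (u v : Fin n) : 0 ≤ effRes G u v := by
  rw [effRes_eq_pinvSqrt hE]
  exact Finset.sum_nonneg fun i _ => mul_self_nonneg _

/-- Foster's theorem, as an inequality. -/
lemma sum_weight_mul_effRes_le (hE : IsEulerian G) :
    (G.map fun e => (e.weight : ℝ) * effRes G e.tail e.head).sum ≤ 2 * n := by
  have hs := undirLaplacian_transpose G
  have h1 := trace_le_card_of_idem (mul_pinv_transpose hs) (mul_pinv_idem hs)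
  rw [Fintype.card_fin] at h1
  -- The trace of the projection `L L⁺` is at most `n`; the factor 1/2, since an arc counts with
  -- half its weight in `G`, accounts for the bound `2n`.
  have h2 : trace (undirLaplacian G * pinv (undirLaplacian G)) =
      (1 / 2 : ℝ) * (G.map fun e => (e.weight : ℝ) * effRes G e.tail e.head).sum := by
    have : ∀ l : List (Arc n), trace ((l.map fun e => (e.weight : ℝ) •
        vecMulVec (edgeVec e.tail e.head) (edgeVec e.tail e.head)).sum *
          pinv (undirLaplacian G)) =
        (l.map fun e => (e.weight : ℝ) * effRes G e.tail e.head).sum := by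
      intro l
      induction l with
      | nil => simp
      | cons e l ih =>
        simp only [List.map_cons, List.sum_cons]
        rw [Matrix.add_mul, trace_add, ih, Matrix.smul_mul, trace_smul, smul_eq_mul, effRes_eq,
          vecMulVec_mul, trace_vecMulVec, ← mulVec_transpose, pinv_transpose]
    nth_rw 1 [undirLaplacian_eq_sum hE]
    rw [Matrix.smul_mul, trace_smul, smul_eq_mul, this]
  linarith

end EffRes
end CycleSparsify
namespace CycleSparsify
open Matrix Finset

/-! ### Oriented cycles -/

/-- A family of arcs that traverse a cycle of the underlying undirected graph, each marked with
whether it agrees with the orientation of the cycle. -/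
structure OrientedCycle (n : ℕ) where
  len : ℕ
  arc : Fin len → Arc n
  fwd : Fin len → Bool

namespace OrientedCycle
variable {n : ℕ}

/-- The clockwise arcs. -/
def cw (Z : OrientedCycle n) : Multiset (Arc n) :=
  (univ.filter fun j => Z.fwd j = true).val.map Z.arc

/-- The counter-clockwise arcs. -/
def ccw (Z : OrientedCycle n) : Multiset (Arc n) :=
  (univ.filter fun j => ¬ Z.fwd j = true).val.map Z.arc

/-- The properties of a short cycle of arcs of equal weight that the analysis relies on. -/
structure Valid (Z : OrientedCycle n) (L : ℕ) : Prop where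
  len_le : Z.len ≤ L
  weight_eq : ∃ w, ∀ j, (Z.arc j).weight = w
  balanced : ∑ j, sgn (Z.fwd j) • edgeVec (Z.arc j).tail (Z.arc j).head = 0
  -- Quantifying over all pseudometrics keeps this property of the closed walk independent of the
  -- graph; it is later used with the effective resistance.
  near : ∃ v₀, ∀ d : Fin n → Fin n → ℝ, (∀ x, d x x = 0) → (∀ x y, d x y = d y x) →
    (∀ x y z, d x z ≤ d x y + d y z) →
    ∀ j, d (Z.arc j).tail v₀ ≤ ∑ j', d (Z.arc j').tail (Z.arc j').head

/-- The Laplacian of the clockwise arcs minus the Laplacian of the counter-clockwise arcs. -/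
def mat (Z : OrientedCycle n) : Matrix (Fin n) (Fin n) ℝ := ∑ j, sgn (Z.fwd j) • arcLap (Z.arc j)

lemma sum_cw {M : Type*} [AddCommMonoid M] (Z : OrientedCycle n) (f : Arc n → M) :
    (Z.cw.map f).sum = ∑ j, if Z.fwd j then f (Z.arc j) else 0 := by
  rw [cw, Multiset.map_map, ← Finset.sum_filter]
  rfl

lemma sum_ccw {M : Type*} [AddCommMonoid M] (Z : OrientedCycle n) (f : Arc n → M) :
    (Z.ccw.map f).sum = ∑ j, if Z.fwd j then 0 else f (Z.arc j) := by
  rw [ccw, Multiset.map_map]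
  calc _ = ∑ j with ¬ Z.fwd j = true, f (Z.arc j) := rfl
    _ = ∑ j, if ¬ Z.fwd j = true then f (Z.arc j) else 0 := Finset.sum_filter _ _
    _ = _ := Finset.sum_congr rfl fun j _ => by split_ifs <;> simp_all

lemma sum_cw_add_sum_ccw {M : Type*} [AddCommMonoid M] (Z : OrientedCycle n) (f : Arc n → M) :
    (Z.cw.map f).sum + (Z.ccw.map f).sum = ∑ j, f (Z.arc j) := by
  rw [sum_cw, sum_ccw, ← Finset.sum_add_distrib]
  exact Finset.sum_congr rfl fun j _ => by split_ifs <;> simp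

lemma sum_cw_sub_sum_ccw {M : Type*} [AddCommGroup M] [Module ℝ M] (Z : OrientedCycle n)
    (f : Arc n → M) :
    (Z.cw.map f).sum - (Z.ccw.map f).sum = ∑ j, sgn (Z.fwd j) • f (Z.arc j) := by
  rw [sum_cw, sum_ccw, ← Finset.sum_sub_distrib]
  exact Finset.sum_congr rfl fun j _ => by split_ifs <;> simp_all [sgn]

lemma card_cw_add_card_ccw (Z : OrientedCycle n) :
    Multiset.card Z.cw + Multiset.card Z.ccw = Z.len := by
  have := sum_cw_add_sum_ccw Z fun _ => 1
  simpa using this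

/-- The arcs in the two directions have the same flow. -/
lemma Valid.flow {Z : OrientedCycle n} {L : ℕ} (hZ : Z.Valid L) :
    (Z.cw.map arcFlow).sum = (Z.ccw.map arcFlow).sum := by
  obtain ⟨w, hw⟩ := hZ.weight_eq
  rw [← sub_eq_zero, sum_cw_sub_sum_ccw]
  simp only [arcFlow, hw, smul_comm _ (w : ℝ)]
  rw [← Finset.smul_sum, hZ.balanced, smul_zero]

end OrientedCycle

/-! ### Variance of one short cycle and of all cycles together -/

section Bound
variable {n : ℕ} {G : DiGraph n}

/-- Cauchy–Schwarz in every coordinate. -/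
lemma dotProduct_sum_smul_le {κ d : Type} [Fintype κ] [Fintype d] (a : κ → ℝ) (u : κ → d → ℝ) :
    (∑ j, a j • u j) ⬝ᵥ (∑ j, a j • u j) ≤ (∑ j, a j ^ 2) * ∑ j, u j ⬝ᵥ u j := by
  simp only [dotProduct]
  rw [Finset.sum_comm, Finset.mul_sum]
  refine Finset.sum_le_sum fun x _ => ?_
  have := Finset.sum_mul_sq_le_sq_mul_sq univ a fun j => u j x
  simpa [← sq, Finset.sum_apply] using this

lemma sub_dotProduct_sub_le {d : Type} [Fintype d] (x y : d → ℝ) :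
    (x - y) ⬝ᵥ (x - y) ≤ 2 * (x ⬝ᵥ x) + 2 * (y ⬝ᵥ y) := by
  simp only [dotProduct, Finset.mul_sum, ← Finset.sum_add_distrib]
  refine Finset.sum_le_sum fun i _ => ?_
  simp only [Pi.sub_apply]
  nlinarith [sq_nonneg (x i + y i)]

lemma sgn_mul_sq (b : Bool) (x : ℝ) : (sgn b * x) ^ 2 = x ^ 2 := by
  rw [mul_pow, sq, sgn_mul_self, one_mul]

/-- If the edges of the cycle `Z` satisfy `w R ≤ ρ`, then the matrix of `Z` and its transpose are
bounded, after normalization on the left, by `O(L² ρ)` times the energy of `Z`. -/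
lemma cycle_mat_bound (hE : IsEulerian G) (hC : StronglyConnected G)
    (hw : ∀ e ∈ G, 0 < e.weight) {Z : OrientedCycle n} {L : ℕ} (hZ : Z.Valid L) {ρ : ℝ}
    (hρ0 : 0 ≤ ρ) (hρ : ∀ j, ((Z.arc j).weight : ℝ) * effRes G (Z.arc j).tail (Z.arc j).head ≤ ρ)
    (y : Fin n → ℝ) :
    (pinvSqrt (undirLaplacian G) *ᵥ (Z.matᵀ *ᵥ y)) ⬝ᵥ
        (pinvSqrt (undirLaplacian G) *ᵥ (Z.matᵀ *ᵥ y)) ≤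
      (L : ℝ) ^ 2 * ρ *
        ∑ j, ((Z.arc j).weight : ℝ) * (y (Z.arc j).tail - y (Z.arc j).head) ^ 2 ∧
    (pinvSqrt (undirLaplacian G) *ᵥ (Z.mat *ᵥ y)) ⬝ᵥ
        (pinvSqrt (undirLaplacian G) *ᵥ (Z.mat *ᵥ y)) ≤
      4 * ((L : ℝ) ^ 2 * ρ *
        ∑ j, ((Z.arc j).weight : ℝ) * (y (Z.arc j).tail - y (Z.arc j).head) ^ 2) := by
  obtain ⟨w, hwt⟩ := hZ.weight_eq
  obtain ⟨v₀, hv₀⟩ := hZ.near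
  have hnear := hv₀ (effRes G) effRes_self effRes_comm (effRes_triangle hE hC hw)
  set S := pinvSqrt (undirLaplacian G)
  set t : Fin Z.len → Fin n := fun j => (Z.arc j).tail
  set h : Fin Z.len → Fin n := fun j => (Z.arc j).head
  set s : Fin Z.len → ℝ := fun j => sgn (Z.fwd j)
  set D := ∑ j, (y (t j) - y (h j)) ^ 2 with hD
  have hD0 : 0 ≤ D := Finset.sum_nonneg fun j _ => sq_nonneg _
  have hlen : (Z.len : ℝ) ≤ L := by exact_mod_cast hZ.len_le
  have hw0 : (0 : ℝ) ≤ w := Nat.cast_nonneg _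
  simp only [hwt] at hρ ⊢
  have hsum : w * ∑ j, effRes G (t j) (h j) ≤ Z.len * ρ := by
    rw [Finset.mul_sum]
    refine (Finset.sum_le_sum fun j _ => hρ j).trans (le_of_eq ?_)
    simp
  have hsum0 : 0 ≤ ∑ j, effRes G (t j) (h j) := Finset.sum_nonneg fun j _ => effRes_nonneg hE _ _
  have hlenL : (Z.len : ℝ) ≤ (L : ℝ) ^ 2 := by
    exact_mod_cast hZ.len_le.trans (Nat.le_self_pow two_ne_zero L)
  have hlen0 : (0 : ℝ) ≤ Z.len := Nat.cast_nonneg _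
  have hlen2 : (Z.len : ℝ) * Z.len ≤ (L : ℝ) ^ 2 := by rw [sq]; gcongr
  rw [← Finset.mul_sum]
  -- One Cauchy–Schwarz estimate for two choices of the second end points: the base vertex `v₀`,
  -- where `c` is the squared length, and the heads, where `c` is the length.
  have hq (a : Fin Z.len → Fin n) {c : ℝ} (hc : w * ∑ j, effRes G (t j) (a j) ≤ c * ρ)
      (hcL : c ≤ (L : ℝ) ^ 2) :
      (∑ j, (s j * (w * (y (t j) - y (h j)))) • (S *ᵥ edgeVec (t j) (a j))) ⬝ᵥ
        (∑ j, (s j * (w * (y (t j) - y (h j)))) • (S *ᵥ edgeVec (t j) (a j))) ≤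
      (L : ℝ) ^ 2 * ρ * (w * D) := by
    refine (dotProduct_sum_smul_le _ _).trans ?_
    have e1 : ∑ j, (s j * (w * (y (t j) - y (h j)))) ^ 2 = w * (w * D) := by
      rw [hD, Finset.mul_sum, Finset.mul_sum]
      exact Finset.sum_congr rfl fun j _ => by rw [sgn_mul_sq]; ring
    have e2 : ∑ j, (S *ᵥ edgeVec (t j) (a j)) ⬝ᵥ (S *ᵥ edgeVec (t j) (a j)) =
        ∑ j, effRes G (t j) (a j) :=
      Finset.sum_congr rfl fun j _ => (effRes_eq_pinvSqrt hE _ _).symm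
    rw [e1, e2]
    calc w * (w * D) * ∑ j, effRes G (t j) (a j)
        = (w * ∑ j, effRes G (t j) (a j)) * (w * D) := by ring
      _ ≤ (c * ρ) * (w * D) := by gcongr
      _ ≤ _ := by gcongr
  have hbal : ∑ j, s j * (y (t j) - y (h j)) = 0 := by
    have := congrArg (· ⬝ᵥ y) hZ.balanced
    simpa only [sum_dotProduct, smul_dotProduct, edgeVec_dotProduct, zero_dotProduct,
      smul_eq_mul] using this
  -- The transpose produces indicator vectors of the tails. Their coefficients sum to zero by
  -- `hbal`, so the indicator of `v₀` can be subtracted from each, giving edge vectors of controlled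
  -- resistance.
  have e1 : S *ᵥ (Z.matᵀ *ᵥ y) =
      ∑ j, (s j * (w * (y (t j) - y (h j)))) • (S *ᵥ edgeVec (t j) v₀) := by
    have : Z.matᵀ *ᵥ y = ∑ j, (s j * (w * (y (t j) - y (h j)))) • edgeVec (t j) v₀ := by
      have h0 : ∑ j, (s j * (w * (y (t j) - y (h j)))) • (Pi.single v₀ 1 : Fin n → ℝ) = 0 := by
        rw [← Finset.sum_smul]
        simp only [mul_left_comm _ (w : ℝ)]
        rw [← Finset.mul_sum, hbal, mul_zero, zero_smul]
      simp only [edgeVec, smul_sub]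
      rw [Finset.sum_sub_distrib, h0, sub_zero, OrientedCycle.mat, transpose_sum, sum_mulVec]
      refine Finset.sum_congr rfl fun j _ => ?_
      rw [transpose_smul, arcLap, transpose_smul, transpose_vecMulVec, smul_mulVec, smul_mulVec,
        vecMulVec_mulVec, edgeVec_dotProduct, hwt]
      ext i
      simp [s, t, h]
      ring
    rw [this, mulVec_sum]
    simp only [mulVec_smul]
  have e2 : S *ᵥ (Z.mat *ᵥ y) =
      ∑ j, (s j * (w * (y (t j) - y (h j)))) • (S *ᵥ edgeVec (t j) (h j)) -
        S *ᵥ (Z.matᵀ *ᵥ y) := by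
    -- The diagonal terms of the symmetrized arcs cancel because both directions carry the same
    -- flow.
    have h0 : Z.mat + Z.matᵀ =
        ∑ j, (s j * w) • vecMulVec (edgeVec (t j) (h j)) (edgeVec (t j) (h j)) := by
      have hd : ∑ j, s j • diagonal (arcFlow (Z.arc j)) = 0 := by
        have : ∑ j, s j • diagonal (arcFlow (Z.arc j)) =
            diagonal (∑ j, s j • arcFlow (Z.arc j)) := by
          ext a b
          rw [Matrix.sum_apply]
          by_cases hab : a = b
          · subst hab; simp
          · simp [hab]
        rw [this, ← OrientedCycle.sum_cw_sub_sum_ccw, hZ.flow, sub_self]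
        exact diagonal_zero
      rw [OrientedCycle.mat, transpose_sum, ← Finset.sum_add_distrib]
      simp only [transpose_smul, ← smul_add, arcLap_add_transpose]
      simp only [smul_add]
      rw [Finset.sum_add_distrib, hd, add_zero]
      exact Finset.sum_congr rfl fun j _ => by rw [hwt, smul_smul]
    rw [eq_sub_iff_add_eq, ← mulVec_add, ← add_mulVec, h0, sum_mulVec, mulVec_sum]
    refine Finset.sum_congr rfl fun j _ => ?_
    rw [smul_mulVec, vecMulVec_mulVec, edgeVec_dotProduct, mulVec_smul, ← mulVec_smul,
      ← mulVec_smul]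
    congr 1
    ext i
    simp
    ring
  -- Each of the `len` tails is within the total resistance of the cycle from `v₀`, and that total,
  -- times `w`, is at most `len * ρ`.
  have hA := hq (fun _ => v₀) (c := Z.len * Z.len) (by
    calc w * ∑ j, effRes G (t j) v₀ ≤ w * ∑ _j : Fin Z.len, ∑ j', effRes G (t j') (h j') := by
          gcongr with j
          exact hnear j
      _ = Z.len * (w * ∑ j, effRes G (t j) (h j)) := by simp; ring
      _ ≤ Z.len * (Z.len * ρ) := by gcongr
      _ = _ := by ring) hlen2
  have hB := hq h (c := Z.len) hsum hlenL
  rw [← e1] at hA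
  refine ⟨hA, ?_⟩
  rw [e2]
  refine (sub_dotProduct_sub_le _ _).trans ?_
  linarith

/-- The matrix variance bound for the normalized Laplacians of disjoint short cycles. -/
lemma cycles_variance_le (hE : IsEulerian G) (hC : StronglyConnected G)
    (hw : ∀ e ∈ G, 0 < e.weight) {ι : Type} [Fintype ι] {Z : ι → OrientedCycle n} {L : ℕ}
    (hZ : ∀ i, (Z i).Valid L) {ρ : ℝ} (hρ0 : 0 ≤ ρ)
    (hρ : ∀ i j, (((Z i).arc j).weight : ℝ) *
      effRes G ((Z i).arc j).tail ((Z i).arc j).head ≤ ρ)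
    (hsub : ∀ f : Arc n → ℝ, (∀ e, 0 ≤ f e) → ∑ i, ∑ j, f ((Z i).arc j) ≤ (G.map f).sum)
    (y : Fin n → ℝ) :
    ∑ i, ((pinvSqrt (undirLaplacian G) * (Z i).mat * pinvSqrt (undirLaplacian G)) *ᵥ y) ⬝ᵥ
        ((pinvSqrt (undirLaplacian G) * (Z i).mat * pinvSqrt (undirLaplacian G)) *ᵥ y) ≤
      8 * ((L : ℝ) ^ 2 * ρ) * (y ⬝ᵥ y) ∧
    ∑ i, ((pinvSqrt (undirLaplacian G) * (Z i).mat * pinvSqrt (undirLaplacian G))ᵀ *ᵥ y) ⬝ᵥ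
        ((pinvSqrt (undirLaplacian G) * (Z i).mat * pinvSqrt (undirLaplacian G))ᵀ *ᵥ y) ≤
      8 * ((L : ℝ) ^ 2 * ρ) * (y ⬝ᵥ y) := by
  set S := pinvSqrt (undirLaplacian G) with hS
  set z := S *ᵥ y with hz
  -- The cycles are disjoint parts of `G`, so their energies sum to at most twice the Laplacian form
  -- of `z`, which is a projection form of `y`. Together with the factor 4 for one cycle this gives
  -- the constant 8.
  have henergy : ∑ i, ∑ j, (((Z i).arc j).weight : ℝ) *
      (z ((Z i).arc j).tail - z ((Z i).arc j).head) ^ 2 ≤ 2 * (y ⬝ᵥ y) := by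
    refine (hsub (fun e => (e.weight : ℝ) * (z e.tail - z e.head) ^ 2)
      fun e => by positivity).trans ?_
    have h1 := dotProduct_undirLaplacian hE z z
    have hs := undirLaplacian_transpose G
    have h2 : z ⬝ᵥ (undirLaplacian G *ᵥ z) ≤ y ⬝ᵥ y := by
      have := dotProduct_mulVec_le_of_idem (mul_pinv_transpose hs) (mul_pinv_idem hs) y
      rw [← pinvSqrt_mul_mul_pinvSqrt (undirLaplacian_posSemidef hE), ← hS, Matrix.mul_assoc,
        ← mulVec_mulVec, ← mulVec_mulVec, dotProduct_mulVec, ← mulVec_transpose,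
        show Sᵀ = S from pinvSqrt_transpose, ← hz] at this
      exact this
    simp only [← sq] at h1
    linarith
  have hb := fun i => cycle_mat_bound hE hC hw (hZ i) hρ0 (hρ i) z
  have hLρ : 0 ≤ (L : ℝ) ^ 2 * ρ := by positivity
  have hfin : ∑ i, 4 * ((L : ℝ) ^ 2 * ρ * ∑ j, (((Z i).arc j).weight : ℝ) *
      (z ((Z i).arc j).tail - z ((Z i).arc j).head) ^ 2) ≤ 8 * ((L : ℝ) ^ 2 * ρ) * (y ⬝ᵥ y) := by
    rw [← Finset.mul_sum, ← Finset.mul_sum]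
    nlinarith [mul_le_mul_of_nonneg_left henergy hLρ]
  refine ⟨le_trans (Finset.sum_le_sum fun i _ => ?_) hfin,
    le_trans (Finset.sum_le_sum fun i _ => ?_) hfin⟩
  · rw [Matrix.mul_assoc, ← mulVec_mulVec, ← mulVec_mulVec]
    exact (hb i).2
  · rw [transpose_mul, transpose_mul, show Sᵀ = S from pinvSqrt_transpose, ← mulVec_mulVec,
      ← mulVec_mulVec]
    refine (hb i).1.trans ?_
    have : 0 ≤ (L : ℝ) ^ 2 * ρ * ∑ j, (((Z i).arc j).weight : ℝ) *
      (z ((Z i).arc j).tail - z ((Z i).arc j).head) ^ 2 :=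
      mul_nonneg hLρ (Finset.sum_nonneg fun j _ => by positivity)
    linarith

end Bound
end CycleSparsify
namespace CycleSparsify

/-! ### Deterministic computations -/

section Timed
variable {α β : Type}

@[simp] lemma Timed.val_bind (x : Timed α) (f : α → Timed β) : (x >>= f).val = (f x.val).val := rfl
@[simp] lemma Timed.steps_bind (x : Timed α) (f : α → Timed β) :
    (x >>= f).steps = x.steps + (f x.val).steps := rfl
@[simp] lemma Timed.val_pure (a : α) : (pure a : Timed α).val = a := rfl
@[simp] lemma Timed.steps_pure (a : α) : (pure a : Timed α).steps = 0 := rfl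
@[simp] lemma op_val (a : α) : (op a).val = a := rfl
@[simp] lemma op_steps (a : α) : (op a).steps = 1 := rfl
@[simp] lemma tick_steps : tick.steps = 1 := rfl

lemma Timed.ite_steps_le {b : Bool} {x y : Timed α} {k : ℕ} (hx : x.steps ≤ k)
    (hy : y.steps ≤ k) : (if b then x else y).steps ≤ k := by
  cases b <;> assumption

lemma Timed.foldlM_val {f : β → α → Timed β} {g : β → α → β} (h : ∀ s x, (f s x).val = g s x)
    (l : List α) (s : β) : (l.foldlM f s).val = l.foldl g s := by
  induction l generalizing s with
  | nil => rfl
  | cons a l ih => rw [List.foldlM_cons, val_bind, ih, h, List.foldl_cons]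

lemma Timed.foldlM_steps_le {f : β → α → Timed β} {k : ℕ} (h : ∀ s x, (f s x).steps ≤ k)
    (l : List α) (s : β) : (l.foldlM f s).steps ≤ k * l.length := by
  induction l generalizing s with
  | nil => exact Nat.zero_le _
  | cons a l ih =>
    rw [List.foldlM_cons, steps_bind, List.length_cons, Nat.mul_succ, add_comm]
    exact Nat.add_le_add (ih _) (h _ _)

/-- Consing reverses the order; multisets forget it, and no later quantity depends on it. -/
lemma foldl_cons_map (f : α → β) (l : List α) (H : List β) :
    ((l.foldl (fun H e => f e :: H) H : List β) : Multiset β) = ↑H + (l : Multiset α).map f := by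
  induction l generalizing H with
  | nil => simp
  | cons a l ih =>
    rw [List.foldl_cons, ih, ← Multiset.cons_coe a l, Multiset.map_cons, ← Multiset.cons_coe (f a)]
    rw [Multiset.cons_add, Multiset.add_cons]

variable {n : ℕ}

/-- Doubles the weight of an arc. -/
def Arc.double (e : Arc n) : Arc n := ⟨e.tail, e.head, 2 * e.weight⟩

lemma addArcs_val (H l : List (Arc n)) : ((addArcs H l).val : Multiset (Arc n)) = ↑H + ↑l := by
  have : (addArcs H l).val = l.foldl (fun H e => e :: H) H :=
    Timed.foldlM_val (fun _ _ => rfl) l H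
  rw [this, foldl_cons_map (fun e => e), Multiset.map_id']

lemma addArcs_steps_le (H l : List (Arc n)) : (addArcs H l).steps ≤ 1 + 2 * l.length :=
  Nat.add_le_add le_rfl (Timed.foldlM_steps_le (k := 2) (fun _ _ => le_rfl) l H)

lemma addDoubled_val (H l : List (Arc n)) :
    ((addDoubled H l).val : Multiset (Arc n)) = ↑H + (l : Multiset (Arc n)).map Arc.double := by
  have : (addDoubled H l).val = l.foldl (fun H e => e.double :: H) H :=
    Timed.foldlM_val (fun _ _ => rfl) l H
  rw [this, foldl_cons_map]

lemma addDoubled_steps_le (H l : List (Arc n)) : (addDoubled H l).steps ≤ 1 + 4 * l.length :=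
  Nat.add_le_add le_rfl (Timed.foldlM_steps_le (k := 4) (fun _ _ => le_rfl) l H)

lemma count_val (l : List α) : (count l).val = l.length := by
  have : (count l).val = l.foldl (fun k _ => k + 1) 0 := Timed.foldlM_val (fun _ _ => rfl) l 0
  rw [this]
  simp

lemma count_steps_le (l : List α) : (count l).steps ≤ 1 + 2 * l.length :=
  Nat.add_le_add le_rfl (Timed.foldlM_steps_le (k := 2) (fun _ _ => le_rfl) l 0)

/-- Whether an arc of a cycle, with the vertex from which it is entered, is traversed from tail to
head. -/
def along {m : ℕ} (arc : Fin m → Arc n) (x : Fin n × Fin m) : Bool := decide ((arc x.2).tail = x.1)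

/-- Whether an arc of a cycle has the direction of the first arc. -/
def agrees {m : ℕ} (arc : Fin m → Arc n) (C : List (Fin n × Fin m)) (x : Fin n × Fin m) : Bool :=
  match C with
  | [] => true
  | x₁ :: _ => along arc x == along arc x₁

lemma foldl_partition {γ : Type} (q : α → Bool) (f : α → γ) (l : List α) (p : List γ × List γ) :
    let r := l.foldl (fun p x => if q x then (f x :: p.1, p.2) else (p.1, f x :: p.2)) p
    (r.1 : Multiset γ) = ↑p.1 + ((l.filter q).map f : List γ) ∧
      (r.2 : Multiset γ) = ↑p.2 + ((l.filter fun x => ¬ q x).map f : List γ) := by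
  induction l generalizing p with
  | nil => simp
  | cons a l ih =>
    simp only [List.foldl_cons]
    refine ⟨(ih _).1.trans ?_, (ih _).2.trans ?_⟩ <;> by_cases h : q a <;>
      simp [h, ← Multiset.cons_coe, ← Multiset.singleton_add, add_comm, add_left_comm, add_assoc,
        -Multiset.coe_add]

lemma orient_spec {m : ℕ} (arc : Fin m → Arc n) {C : List (Fin n × Fin m)} (hC : C ≠ []) :
    ((orient arc C).val.1 : Multiset (Arc n)) =
        ((C.filter (agrees arc C)).map (fun x => arc x.2) : List (Arc n)) ∧
      ((orient arc C).val.2 : Multiset (Arc n)) =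
        ((C.filter fun x => ¬ agrees arc C x).map (fun x => arc x.2) : List (Arc n)) ∧
      (orient arc C).steps ≤ 2 + 5 * C.length := by
  match C with
  | [] => exact absurd rfl hC
  | (v₁, j₁) :: t =>
    have hval : (orient arc ((v₁, j₁) :: t)).val = ((v₁, j₁) :: t).foldl
        (fun (p : List (Arc n) × List (Arc n)) x =>
          if agrees arc ((v₁, j₁) :: t) x then (arc x.2 :: p.1, p.2) else (p.1, arc x.2 :: p.2))
        ([], []) := by
      refine Timed.foldlM_val (fun p x => ?_) _ _
      simp only [Timed.val_bind, op_val]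
      show (if agrees arc ((v₁, j₁) :: t) x then _ else _ : Timed _).val = _
      split_ifs <;> rfl
    have h := foldl_partition (agrees arc ((v₁, j₁) :: t)) (fun x => arc x.2) ((v₁, j₁) :: t)
      ([], [])
    refine ⟨by rw [hval]; simpa using h.1, by rw [hval]; simpa using h.2, ?_⟩
    refine (Nat.add_assoc 1 1 _).symm.le.trans (Nat.add_le_add le_rfl
      (Timed.foldlM_steps_le (fun p x => ?_) _ _))
    have := Timed.ite_steps_le (b := along arc x == along arc (v₁, j₁)) (k := 1)
      (x := do
        let F ← op (arc x.2 :: p.1)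
        pure (F, p.2))
      (y := do
        let S ← op (arc x.2 :: p.2)
        pure (p.1, S)) le_rfl le_rfl
    exact Nat.add_le_add_left (Nat.add_le_add_left (Nat.add_le_add_left
      (Nat.add_le_add_left this 1) 1) 1) 1

/-- A cycle of the undirected graph underlying an array of arcs as an oriented cycle. -/
def toOriented {m : ℕ} (arc : Fin m → Arc n) (C : List (Fin n × Fin m)) : OrientedCycle n where
  len := C.length
  arc j := arc (C.get j).2
  fwd j := agrees arc C (C.get j)

lemma filter_univ_map_get (l : List α) (q : α → Prop) [DecidablePred q] (f : α → β) :
    (Finset.univ.filter fun j : Fin l.length => q (l.get j)).val.map (fun j => f (l.get j)) =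
      ((l.filter q).map f : List β) := by
  have h : (Finset.univ : Finset (Fin l.length)).val.map l.get = (l : Multiset α) := by
    rw [Fin.univ_val_map, List.ofFn_get]
  rw [← Multiset.map_coe, ← Multiset.filter_coe, ← h, Multiset.filter_map, Multiset.map_map]
  rfl

lemma toOriented_cw {m : ℕ} (arc : Fin m → Arc n) (C : List (Fin n × Fin m)) :
    (toOriented arc C).cw = ((C.filter (agrees arc C)).map (fun x => arc x.2) : List (Arc n)) := by
  refine (filter_univ_map_get C (fun x => agrees arc C x = true) fun x => arc x.2).trans ?_
  simp

lemma toOriented_ccw {m : ℕ} (arc : Fin m → Arc n) (C : List (Fin n × Fin m)) :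
    (toOriented arc C).ccw =
      ((C.filter fun x => ¬ agrees arc C x).map (fun x => arc x.2) : List (Arc n)) :=
  filter_univ_map_get C (fun x => ¬ agrees arc C x = true) (fun x => arc x.2)

lemma toOriented_cw_add_ccw {m : ℕ} (arc : Fin m → Arc n) (C : List (Fin n × Fin m)) :
    (toOriented arc C).cw + (toOriented arc C).ccw = (C.map (fun x => arc x.2) : List (Arc n)) := by
  have h := congrArg (Multiset.map fun x => arc x.2)
    (Multiset.filter_add_not (fun x => agrees arc C x = true) (C : Multiset (Fin n × Fin m)))
  rw [Multiset.map_add, Multiset.filter_coe, Multiset.filter_coe, Multiset.map_coe,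
    Multiset.map_coe, Multiset.map_coe] at h
  rw [toOriented_cw, toOriented_ccw, ← h]
  simp only [Bool.decide_eq_true]

lemma sum_mod_succ {M : Type*} [AddCommMonoid M] (k : ℕ) (g : ℕ → M) :
    ∑ j ∈ Finset.range k, g ((j + 1) % k) = ∑ j ∈ Finset.range k, g j := by
  cases k with
  | zero => simp
  | succ k =>
    rw [Finset.sum_range_succ, Finset.sum_range_succ', Nat.mod_self]
    congr 1
    refine Finset.sum_congr rfl fun j hj => ?_
    rw [Nat.mod_eq_of_lt (by have := Finset.mem_range.1 hj; omega)]

lemma sgn_beq (b c : Bool) : sgn (b == c) = sgn c * sgn b := by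
  cases b <;> cases c <;> simp [sgn]

/-- Each arc joins consecutive vertices of the cycle, forwards or backwards. Signed edge vectors
therefore telescope around the cycle, and the triangle inequality along the walk bounds distances
from its first vertex. -/
lemma toOriented_valid {m : ℕ} {arc : Fin m → Arc n} {C : List (Fin n × Fin m)} {L w : ℕ}
    (hC : IsCycle (fun j => s((arc j).tail, (arc j).head)) C) (hL : C.length ≤ L)
    (hw : ∀ j, (arc j).weight = w) (hl : ∀ j, (arc j).tail ≠ (arc j).head) :
    (toOriented arc C).Valid L := by
  obtain ⟨hne, -, -, hends⟩ := hC
  have hpos : 0 < C.length := List.length_pos_of_ne_nil hne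
  -- Indices are taken modulo the length, so `v (j + 1)` makes sense also for the last arc, where
  -- the cycle closes.
  let v : ℕ → Fin n := fun i => (C[i % C.length]'(Nat.mod_lt _ hpos)).1
  have hv (j : Fin C.length) : v j = (C.get j).1 := by
    simp only [v, Nat.mod_eq_of_lt j.2]; rfl
  have hcase (j : Fin C.length) :
      (along arc (C.get j) = true ∧ (arc (C.get j).2).tail = v j ∧
        (arc (C.get j).2).head = v (j + 1)) ∨
      (along arc (C.get j) = false ∧ (arc (C.get j).2).tail = v (j + 1) ∧
        (arc (C.get j).2).head = v j) := by
    have h := hends j j.2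
    have h' : s((arc (C.get j).2).tail, (arc (C.get j).2).head) = s(v j, v (j + 1)) := by
      rw [hv]; exact h
    rcases Sym2.eq_iff.1 h' with ⟨h1, h2⟩ | ⟨h1, h2⟩
    · exact Or.inl ⟨by rw [along, h1, hv]; simp, h1, h2⟩
    · refine Or.inr ⟨?_, h1, h2⟩
      rw [along, ← hv, ← h2]
      simpa using hl _
  refine ⟨hL, ⟨w, fun j => hw _⟩, ?_, ⟨v 0, fun d d0 dsymm dtri j => ?_⟩⟩
  -- Clockwise means agreeing with the first arc, not with the listing; the two notions differ by
  -- the global sign `sgn c`, which does not affect a sum that vanishes.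
  · have hag : ∃ c, ∀ x, agrees arc C x = (along arc x == c) := by
      match C, hne with
      | x₁ :: t, _ => exact ⟨along arc x₁, fun x => rfl⟩
    obtain ⟨c, hc⟩ := hag
    obtain ⟨g, hg⟩ : ∃ g : ℕ → Fin n → ℝ,
        ∀ i, g i = Pi.single (v i) 1 - Pi.single (v (i + 1)) 1 := ⟨_, fun _ => rfl⟩
    have hterm (j : Fin C.length) : sgn ((toOriented arc C).fwd j) •
        edgeVec ((toOriented arc C).arc j).tail ((toOriented arc C).arc j).head =
        sgn c • g j := by
      rw [hg]
      simp only [toOriented, hc, sgn_beq, mul_smul]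
      congr 1
      rcases hcase j with ⟨h0, h1, h2⟩ | ⟨h0, h1, h2⟩ <;> rw [h0, h1, h2] <;> simp [sgn, edgeVec]
    show ∑ j : Fin C.length, _ = _
    rw [Finset.sum_congr rfl fun j _ => hterm j, ← Finset.smul_sum,
      Fin.sum_univ_eq_sum_range]
    simp only [hg]
    rw [Finset.sum_sub_distrib]
    have hper : ∀ i, v (i + 1) = v ((i + 1) % C.length) := fun i => by simp only [v, Nat.mod_mod]
    simp only [hper _]
    rw [sum_mod_succ C.length fun i => (Pi.single (v i) 1 : Fin n → ℝ), sub_self, smul_zero]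
  · have dnn (x y : Fin n) : 0 ≤ d x y := by
      have := dtri x y x
      rw [d0, dsymm y x] at this
      linarith
    have hstep (j : Fin C.length) : d (arc (C.get j).2).tail (arc (C.get j).2).head =
        d (v j) (v (j + 1)) := by
      rcases hcase j with ⟨-, h1, h2⟩ | ⟨-, h1, h2⟩ <;> rw [h1, h2]
      exact dsymm _ _
    have hpath (i : ℕ) : d (v i) (v 0) ≤ ∑ j ∈ Finset.range i, d (v j) (v (j + 1)) := by
      induction i with
      | zero => rw [d0]; simp
      | succ i ih =>
        rw [Finset.sum_range_succ]
        have := dtri (v (i + 1)) (v i) (v 0)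
        rw [dsymm (v (i + 1)) (v i)] at this
        linarith
    have htot (i : ℕ) : d (v i) (v 0) ≤ ∑ j ∈ Finset.range C.length, d (v j) (v (j + 1)) := by
      have : v i = v (i % C.length) := by simp only [v, Nat.mod_mod]
      rw [this]
      refine (hpath _).trans (Finset.sum_le_sum_of_subset_of_nonneg ?_ fun _ _ _ => dnn _ _)
      exact Finset.range_mono (Nat.mod_lt _ hpos).le
    have hsum : ∑ j', d ((toOriented arc C).arc j').tail ((toOriented arc C).arc j').head =
        ∑ j ∈ Finset.range C.length, d (v j) (v (j + 1)) := by
      rw [← Fin.sum_univ_eq_sum_range (fun j => d (v j) (v (j + 1)))]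
      exact Finset.sum_congr rfl fun j _ => hstep j
    rw [hsum]
    rcases hcase j with ⟨-, h1, -⟩ | ⟨-, h1, -⟩
    · exact (congrArg (d · (v 0)) h1).le.trans (htot _)
    · exact (congrArg (d · (v 0)) h1).le.trans (htot _)

end Timed
end CycleSparsify
namespace CycleSparsify

/-! ### Randomized computations -/

section Uniform

lemma uniformOfFintype_map_equiv {α β : Type} [Fintype α] [Nonempty α] [Fintype β] [Nonempty β]
    (e : α ≃ β) : (PMF.uniformOfFintype α).map e = PMF.uniformOfFintype β := by
  ext b
  rw [PMF.map_apply, tsum_eq_single (e.symm b)]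
  · simp [Fintype.card_congr e]
  · intro a ha
    rw [if_neg]
    rintro rfl
    exact ha (e.symm_apply_apply a).symm

/-- Two successive independent uniform choices form one uniform choice of a pair; this merges the
coins of consecutive program parts. -/
lemma uniformOfFintype_bind_map {α β : Type} [Fintype α] [Nonempty α] [Fintype β] [Nonempty β] :
    (PMF.uniformOfFintype α).bind (fun a => (PMF.uniformOfFintype β).map (Prod.mk a)) =
      PMF.uniformOfFintype (α × β) := by
  ext ⟨a, b⟩
  rw [PMF.bind_apply, tsum_eq_single a]
  · rw [PMF.map_apply, tsum_eq_single b]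
    · simp only [PMF.uniformOfFintype_apply, if_true, Fintype.card_prod, Nat.cast_mul]
      rw [ENNReal.mul_inv] <;> simp
    · intro b' hb'
      rw [if_neg]
      simpa using hb'.symm
  · intro a' ha'
    rw [PMF.map_apply, ENNReal.tsum_eq_zero.2, mul_zero]
    intro b'
    rw [if_neg]
    simp only [Prod.mk.injEq, not_and]
    exact fun h => absurd h.symm ha'

end Uniform

section RandTimed
variable {α β : Type}

/-- The joint distribution of the result and the number of steps. -/
def RandTimed.dist (x : RandTimed α) : PMF (α × ℕ) := x

lemma RandTimed.dist_bind (x : RandTimed α) (f : α → RandTimed β) :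
    (x >>= f).dist =
      x.dist.bind fun p => (f p.1).dist.map (fun q => (q.1, p.2 + q.2)) := rfl

lemma RandTimed.dist_lift (t : Timed α) :
    (liftM t : RandTimed α).dist = PMF.pure (t.val, t.steps) := rfl

lemma RandTimed.dist_lift_bind (t : Timed α) (f : α → RandTimed β) :
    ((liftM t : RandTimed α) >>= f).dist =
      (f t.val).dist.map (fun q => (q.1, t.steps + q.2)) := by
  rw [dist_bind, dist_lift, PMF.pure_bind]

/-! ### Programs as samplers of independent cycle orientations -/

variable {n : ℕ}

/-- `f` adds to its argument the arcs in `B` and, for each cycle `Z i` independently, the clockwise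
or the counter-clockwise arcs with twice their weight, in at most `T` steps. -/
def Samples (f : List (Arc n) → RandTimed (List (Arc n))) (ι : Type) [Fintype ι] [DecidableEq ι]
    (B : Multiset (Arc n)) (Z : ι → OrientedCycle n) (T : ℕ) : Prop :=
  ∀ H, ∃ g : (ι → Bool) → List (Arc n) × ℕ,
    (f H).dist = PMF.map g (PMF.uniformOfFintype (ι → Bool)) ∧
    ∀ σ, ((g σ).1 : Multiset (Arc n)) =
        ↑H + B + ∑ i, (if σ i then (Z i).cw else (Z i).ccw).map Arc.double ∧ (g σ).2 ≤ T

/-- `f` samples from some decomposition of the arcs `l` into short cycles and at most `b` arcs that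
are kept. -/
def SamplesCycles (f : List (Arc n) → RandTimed (List (Arc n))) (l : Multiset (Arc n))
    (b L T : ℕ) : Prop :=
  ∃ (ι : Type) (_ : Fintype ι) (_ : DecidableEq ι) (B : Multiset (Arc n))
    (Z : ι → OrientedCycle n), l = B + ∑ i, ((Z i).cw + (Z i).ccw) ∧ Multiset.card B ≤ b ∧
      (∀ i, (Z i).Valid L) ∧ Samples f ι B Z T

/-- The decomposition of the second part is fixed before its input list, so the coins of both parts
are independent: the index set is the disjoint union, and uniform signs on it are a pair of uniform
signs. -/
lemma SamplesCycles.comp {f f' : List (Arc n) → RandTimed (List (Arc n))}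
    {l l' : Multiset (Arc n)} {b b' L T T' : ℕ} (h : SamplesCycles f l b L T)
    (h' : SamplesCycles f' l' b' L T') :
    SamplesCycles (fun H => f H >>= f') (l + l') (b + b') L (T + T') := by
  obtain ⟨ι, _, _, B, Z, hl, hb, hZ, hs⟩ := h
  obtain ⟨κ, _, _, B', Z', hl', hb', hZ', hs'⟩ := h'
  refine ⟨ι ⊕ κ, inferInstance, inferInstance, B + B', Sum.elim Z Z', ?_, ?_, ?_, fun H => ?_⟩
  · rw [hl, hl', Fintype.sum_sum_type]
    simp only [Sum.elim_inl, Sum.elim_inr]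
    exact add_add_add_comm _ _ _ _
  · rw [Multiset.card_add]
    exact Nat.add_le_add hb hb'
  · rintro (i | i)
    · exact hZ i
    · exact hZ' i
  · obtain ⟨g, hg, hg'⟩ := hs H
    choose k hk hk' using hs'
    refine ⟨fun σ => ((k (g fun i => σ (Sum.inl i)).1 fun i => σ (Sum.inr i)).1,
      (g fun i => σ (Sum.inl i)).2 + (k (g fun i => σ (Sum.inl i)).1 fun i => σ (Sum.inr i)).2),
      ?_, fun σ => ⟨?_, Nat.add_le_add (hg' _).2 (hk' _ _).2⟩⟩
    · rw [RandTimed.dist_bind, hg,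
        ← uniformOfFintype_map_equiv (Equiv.sumArrowEquivProdArrow ι κ Bool).symm,
        ← uniformOfFintype_bind_map, PMF.bind_map, PMF.map_comp, PMF.map_bind]
      congr 1
      funext σ
      simp only [Function.comp_apply]
      rw [hk, PMF.map_comp, PMF.map_comp]
      rfl
    · rw [(hk' _ _).1, (hg' _).1, Fintype.sum_sum_type]
      simp only [Sum.elim_inl, Sum.elim_inr, add_assoc]
      congr 2
      exact add_left_comm _ _ _

lemma SamplesCycles.mono {f : List (Arc n) → RandTimed (List (Arc n))}
    {l : Multiset (Arc n)} {b b' L T T' : ℕ} (h : SamplesCycles f l b L T) (hb : b ≤ b')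
    (hT : T ≤ T') : SamplesCycles f l b' L T' := by
  obtain ⟨ι, i1, i2, B, Z, hl, hb0, hZ, hs⟩ := h
  refine ⟨ι, i1, i2, B, Z, hl, hb0.trans hb, hZ, fun H => ?_⟩
  obtain ⟨g, hg, hg'⟩ := hs H
  exact ⟨g, hg, fun σ => ⟨(hg' σ).1, (hg' σ).2.trans hT⟩⟩

/-- A deterministic computation that does not depend on the argument only takes time. -/
lemma SamplesCycles.lift_bind {t : Timed α} {f : α → List (Arc n) → RandTimed (List (Arc n))}
    {l : Multiset (Arc n)} {b L T : ℕ} (h : SamplesCycles (f t.val) l b L T) :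
    SamplesCycles (fun H => (liftM t : RandTimed α) >>= fun a => f a H) l b L (t.steps + T) := by
  obtain ⟨ι, i1, i2, B, Z, hl, hb, hZ, hs⟩ := h
  refine ⟨ι, i1, i2, B, Z, hl, hb, hZ, fun H => ?_⟩
  obtain ⟨g, hg, hg'⟩ := hs H
  refine ⟨fun σ => ((g σ).1, t.steps + (g σ).2), ?_,
    fun σ => ⟨(hg' σ).1, Nat.add_le_add_left (hg' σ).2 _⟩⟩
  rw [RandTimed.dist_lift_bind, hg, PMF.map_comp]
  rfl

/-- A deterministic computation that adds the arcs in `B`. -/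
lemma SamplesCycles.of_timed {t : List (Arc n) → Timed (List (Arc n))} {B : Multiset (Arc n)}
    {T : ℕ} (L : ℕ) (h : ∀ H, ((t H).val : Multiset (Arc n)) = ↑H + B ∧ (t H).steps ≤ T) :
    SamplesCycles (fun H => (liftM (t H) : RandTimed (List (Arc n)))) B (Multiset.card B) L T := by
  refine ⟨Empty, inferInstance, inferInstance, B, Empty.elim, by simp, le_rfl, fun i => i.elim,
    fun H => ⟨fun _ => ((t H).val, (t H).steps), ?_, fun σ => ⟨by simp [(h H).1], (h H).2⟩⟩⟩
  rw [RandTimed.dist_lift]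
  exact (PMF.map_const _ _).symm

lemma SamplesCycles.pure (L : ℕ) :
    SamplesCycles (fun H : List (Arc n) => (Pure.pure H : RandTimed (List (Arc n)))) 0 0 L 0 :=
  SamplesCycles.of_timed (t := fun H => Pure.pure H) L fun H => ⟨by simp, le_rfl⟩

lemma SamplesCycles.foldlM {f : List (Arc n) → α → RandTimed (List (Arc n))}
    {l : α → Multiset (Arc n)} {b T : α → ℕ} {L : ℕ} {xs : List α}
    (h : ∀ x ∈ xs, SamplesCycles (fun H => f H x) (l x) (b x) L (T x)) :
    SamplesCycles (fun H => xs.foldlM f H) (xs.map l).sum (xs.map b).sum L (xs.map T).sum := by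
  induction xs with
  | nil => exact SamplesCycles.pure L
  | cons x xs ih =>
    simp only [List.foldlM_cons, List.map_cons, List.sum_cons]
    exact (h x (by simp)).comp (ih fun y hy => h y (List.mem_cons_of_mem _ hy))

lemma dist_coin_bind (f : Bool → RandTimed β) :
    (coin >>= f).dist = (PMF.uniformOfFintype Bool).bind
      fun b => (f b).dist.map (fun q => (q.1, 1 + q.2)) := by
  rw [RandTimed.dist_bind, show coin.dist =
    PMF.map (fun b => (b, 1)) (PMF.uniformOfFintype Bool) from rfl, PMF.bind_map]
  rfl

/-- The index set is a single point, carrying one coin. The cost is at most `5 + 9ℓ` for length `ℓ`,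
hence at most `14ℓ` because a cycle is nonempty; absorbing the constant lets costs be summed over
cycles. -/
lemma sparsifyCycle_samples {m : ℕ} {arc : Fin m → Arc n} {C : List (Fin n × Fin m)} {L w : ℕ}
    (hC : IsCycle (fun j => s((arc j).tail, (arc j).head)) C) (hL : C.length ≤ L)
    (hw : ∀ j, (arc j).weight = w) (hl : ∀ j, (arc j).tail ≠ (arc j).head) :
    SamplesCycles (fun H => sparsifyCycle arc H C) (C.map (fun x => arc x.2) : List (Arc n)) 0 L
      (14 * C.length) := by
  obtain ⟨h1, h2, h3⟩ := orient_spec arc hC.1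
  have hpos : 1 ≤ C.length := List.length_pos_of_ne_nil hC.1
  have hlen : (orient arc C).val.1.length + (orient arc C).val.2.length = C.length := by
    have := congrArg Multiset.card (toOriented_cw_add_ccw arc C)
    rw [toOriented_cw, toOriented_ccw, ← h1, ← h2] at this
    simpa using this
  refine SamplesCycles.mono (b := 0)
    (T := tick.steps + ((orient arc C).steps + (1 + (1 + 4 * C.length))))
    (SamplesCycles.lift_bind (SamplesCycles.lift_bind
      ⟨Unit, inferInstance, inferInstance, 0, fun _ => toOriented arc C, ?_, by simp,
        fun _ => toOriented_valid hC hL hw hl, fun H => ?_⟩)) le_rfl ?_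
  · simp [toOriented_cw_add_ccw]
  · let a : Bool → Timed (List (Arc n)) := fun b =>
      addDoubled H (if b then (orient arc C).val.1 else (orient arc C).val.2)
    have key : ∀ b : Bool, (if b then (liftM (addDoubled H (orient arc C).val.1) : RandTimed _)
        else liftM (addDoubled H (orient arc C).val.2)).dist.map (fun q => (q.1, 1 + q.2)) =
        PMF.pure ((a b).val, 1 + (a b).steps) := by
      rintro (_ | _) <;> exact PMF.pure_map _ _
    refine ⟨fun σ => ((a (σ ())).val, 1 + (a (σ ())).steps), ?_, fun σ => ⟨?_, ?_⟩⟩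
    · rw [dist_coin_bind, ← uniformOfFintype_map_equiv (Equiv.funUnique Unit Bool), PMF.bind_map,
        ← PMF.bind_pure_comp]
      congr 1
      funext σ
      exact key (σ ())
    · simp only [a, addDoubled_val, Finset.univ_unique, Finset.sum_singleton, PUnit.default_eq_unit,
        toOriented_cw, toOriented_ccw, ← h1, ← h2, add_zero]
      cases σ () <;> rfl
    · refine Nat.add_le_add_left ((addDoubled_steps_le _ _).trans ?_) _
      split_ifs <;> omega
  · rw [tick_steps]
    omega

/-- What `sparsifyClass` does to a class of arcs of equal weight. -/
lemma sparsifyClass_samples {CD : CycleAlg n} {mhat L θ : ℕ} {T : ℕ → ℕ}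
    (hCD : IsShortCycleAlg CD mhat L T) {l : List (Arc n)} {w : ℕ}
    (hw : ∀ e ∈ l, e.weight = w) (hl : ∀ e ∈ l, e.tail ≠ e.head) :
    SamplesCycles (fun H => sparsifyClass CD θ H l) l (θ + mhat) L
      (5 + 21 * l.length + if θ ≤ l.length then T l.length else 0) := by
  have hcount := count_steps_le l
  by_cases hsmall : l.length < θ
  · refine SamplesCycles.mono (b := l.length)
      (T := tick.steps + ((count l).steps + (1 + (1 + 2 * l.length))))
      (SamplesCycles.lift_bind (SamplesCycles.lift_bind (SamplesCycles.lift_bind ?_)))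
      (by omega) (by rw [tick_steps]; omega)
    simp only [op_val, count_val, hsmall, decide_true, if_true]
    have := SamplesCycles.of_timed L (t := fun H => addArcs H l) (B := l) (T := 1 + 2 * l.length)
      fun H => ⟨addArcs_val H l, addArcs_steps_le H l⟩
    simpa using this
  · have hθ : θ ≤ l.length := not_lt.1 hsmall
    obtain ⟨hD, hsteps⟩ := hCD l.length (fun j => s((l.get j).tail, (l.get j).head)) (fun j => by
      rw [Sym2.mk_isDiag_iff]
      exact hl _ (List.get_mem _ _))
    set D := (CD l.length fun j => s((l.get j).tail, (l.get j).head)) with hDdef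
    obtain ⟨hperm, hcyc, hrest⟩ := hD
    -- Every arc is either on exactly one cycle or left over, so the cost of all cycles and
    -- leftovers is linear in the class.
    have hlen : (D.val.cycles.map fun C => 14 * C.length).sum + 3 * D.val.rest.length ≤
        14 * l.length := by
      have h1 := hperm.length_eq
      rw [List.length_append, List.length_map, List.length_flatten, List.length_finRange] at h1
      rw [List.sum_map_mul_left]
      have h2 : (D.val.cycles.map fun C => C.length).sum =
        (D.val.cycles.map List.length).sum := rfl
      omega
    have hkeep : SamplesCycles (fun H => D.val.rest.foldlM (fun H j => (liftM (do
          tick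
          let e ← op (l.get j)
          op (e :: H) : Timed (List (Arc n))) : RandTimed (List (Arc n)))) H)
        ((D.val.rest.map l.get : List (Arc n)) : Multiset (Arc n)) D.val.rest.length L
        (3 * D.val.rest.length) := by
      have := SamplesCycles.foldlM (L := L) (xs := D.val.rest) (T := fun _ => 3) fun j _ =>
        SamplesCycles.of_timed (t := fun H : List (Arc n) => (do
          tick
          let e ← op (l.get j)
          op (e :: H) : Timed (List (Arc n)))) (B := {l.get j}) (T := 3) L
        fun H => ⟨by rw [add_comm, Multiset.singleton_add]; rfl, le_rfl⟩
      convert this using 1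
      · rw [← Multiset.map_coe, ← Multiset.sum_map_singleton (Multiset.map _ _),
          Multiset.map_map, Multiset.map_coe, Multiset.sum_coe]
        rfl
      · simp
      · simp [mul_comm]
    have hrun := hkeep.comp (SamplesCycles.foldlM (L := L) (xs := D.val.cycles)
      (f := sparsifyCycle l.get) (b := fun _ => 0) fun C hC =>
        sparsifyCycle_samples (hcyc C hC).1 (hcyc C hC).2
          (fun j => hw _ (List.get_mem _ _)) fun j => hl _ (List.get_mem _ _))
    have hl' : (l : Multiset (Arc n)) =
        ((D.val.rest.map l.get : List (Arc n)) : Multiset (Arc n)) +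
          (D.val.cycles.map fun C =>
            ((C.map (fun x => l.get x.2) : List (Arc n)) : Multiset (Arc n))).sum := by
      have h1 : ∀ cs : List (List (Fin n × Fin l.length)), (cs.map fun C =>
          ((C.map (fun x => l.get x.2) : List (Arc n)) : Multiset (Arc n))).sum =
          ((cs.flatten.map Prod.snd).map l.get : List (Arc n)) := by
        intro cs
        induction cs with
        | nil => rfl
        | cons C cs ih =>
          rw [List.map_cons, List.sum_cons, ih, List.flatten_cons, List.map_append,
            List.map_append, ← Multiset.coe_add, List.map_map (l := C)]
          rfl
      rw [h1, Multiset.coe_add, ← List.map_append]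
      have h2 := (List.perm_append_comm.trans hperm).map l.get
      rw [List.map_get_finRange] at h2
      exact (Multiset.coe_eq_coe.2 h2).symm
    rw [← hl'] at hrun
    refine SamplesCycles.mono (b := D.val.rest.length) (T := tick.steps + ((count l).steps + (1 +
        ((2 * l.length + 1) + ((3 * l.length + 1) + (D.steps + (3 * D.val.rest.length +
          (D.val.cycles.map fun C => 14 * C.length).sum)))))))
      (SamplesCycles.lift_bind (SamplesCycles.lift_bind (SamplesCycles.lift_bind ?_)))
      (by omega) (by rw [tick_steps, if_pos hθ]; omega)
    simp only [op_val, count_val, hsmall, decide_false, Bool.false_eq_true, if_false]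
    refine SamplesCycles.lift_bind (t := toArray l) (SamplesCycles.lift_bind
      (t := endsArray l.get) (SamplesCycles.lift_bind (t := D) ?_))
    exact hrun.mono (b' := D.val.rest.length) (by simp) le_rfl

end RandTimed
end CycleSparsify
namespace CycleSparsify

/-! ### The run of one round of sparsification -/

section Run
variable {n : ℕ}

lemma foldl_max_spec {α : Type} (f : α → ℕ) (l : List α) (s : ℕ) :
    s ≤ l.foldl (fun s x => max s (f x)) s ∧
    (∀ x ∈ l, f x ≤ l.foldl (fun s x => max s (f x)) s) ∧
    ∀ K, s ≤ K → (∀ x ∈ l, f x ≤ K) → l.foldl (fun s x => max s (f x)) s ≤ K := by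
  induction l generalizing s with
  | nil => simp
  | cons a l ih =>
    obtain ⟨h1, h2, h3⟩ := ih (max s (f a))
    rw [List.foldl_cons]
    refine ⟨(le_max_left _ _).trans h1, ?_, fun K hs hK => h3 K
      (max_le hs (hK a (by simp))) fun x hx => hK x (List.mem_cons_of_mem _ hx)⟩
    intro x hx
    rcases List.mem_cons.1 hx with rfl | hx
    · exact (le_max_right _ _).trans h1
    · exact h2 x hx

lemma numClasses_val (G : DiGraph n) :
    (numClasses G).val = G.foldl (fun s e => max s (Nat.log 2 e.weight + 1)) 0 :=
  Timed.foldlM_val (fun _ _ => rfl) G 0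

lemma log_weight_lt_numClasses {G : DiGraph n} {e : Arc n} (he : e ∈ G) :
    Nat.log 2 e.weight < (numClasses G).val := by
  rw [numClasses_val]
  exact (foldl_max_spec (fun e : Arc n => Nat.log 2 e.weight + 1) G 0).2.1 e he

lemma numClasses_val_le {G : DiGraph n} {K : ℕ} (h : ∀ e ∈ G, Nat.log 2 e.weight ≤ K) :
    (numClasses G).val ≤ K + 1 := by
  rw [numClasses_val]
  exact (foldl_max_spec (fun e : Arc n => Nat.log 2 e.weight + 1) G 0).2.2 _ (Nat.zero_le _)
    fun e he => Nat.succ_le_succ (h e he)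

lemma numClasses_steps_le (G : DiGraph n) : (numClasses G).steps ≤ 1 + 4 * G.length :=
  Nat.add_le_add le_rfl (Timed.foldlM_steps_le (k := 4) (fun _ _ => le_rfl) G 0)

/-- The arc at position `i` has too large a leverage score to be sampled. -/
def IsHeavy (G : DiGraph n) (r : Fin G.length → ℝ) (i : Fin G.length) : Prop :=
  4 * (n : ℝ) / (G.length : ℝ) < ((G.get i).weight : ℝ) / 2 * r i

noncomputable instance (G : DiGraph n) (r : Fin G.length → ℝ) : DecidablePred (IsHeavy G r) :=
  fun _ => Real.decidableLT _ _

/-- One step of `split`. -/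
noncomputable def splitStep (G : DiGraph n) (r : Fin G.length → ℝ)
    (p : List (Arc n) × (ℕ → List (Arc n))) (i : Fin G.length) :
    List (Arc n) × (ℕ → List (Arc n)) :=
  if decide (IsHeavy G r i) then (G.get i :: p.1, p.2)
  else (p.1, Function.update p.2 (Nat.log 2 (G.get i).weight)
    (G.get i :: p.2 (Nat.log 2 (G.get i).weight)))

lemma splitStep_of_heavy {G : DiGraph n} {r : Fin G.length → ℝ} {i : Fin G.length}
    (h : IsHeavy G r i) (p : List (Arc n) × (ℕ → List (Arc n))) :
    splitStep G r p i = (G.get i :: p.1, p.2) := by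
  simp [splitStep, h]

lemma splitStep_of_not_heavy {G : DiGraph n} {r : Fin G.length → ℝ} {i : Fin G.length}
    (h : ¬ IsHeavy G r i) (p : List (Arc n) × (ℕ → List (Arc n))) :
    splitStep G r p i = (p.1, Function.update p.2 (Nat.log 2 (G.get i).weight)
      (G.get i :: p.2 (Nat.log 2 (G.get i).weight))) := by
  simp [splitStep, h]

lemma split_val (G : DiGraph n) (r : Fin G.length → ℝ) (B₀ : ℕ → List (Arc n)) :
    (split G r B₀).val = (List.finRange G.length).foldl (splitStep G r) ([], B₀) := by
  refine Timed.foldlM_val (fun p i => ?_) _ _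
  show (if decide (IsHeavy G r i) then _ else _ : Timed _).val =
    (if decide (IsHeavy G r i) then _ else _)
  cases decide (IsHeavy G r i) <;> rfl

lemma split_steps_le (G : DiGraph n) (r : Fin G.length → ℝ) (B₀ : ℕ → List (Arc n)) :
    (split G r B₀).steps ≤ 12 * G.length := by
  refine le_of_le_of_eq (Timed.foldlM_steps_le (k := 12) (fun p i => ?_) _ _)
    (by rw [List.length_finRange])
  have := Timed.ite_steps_le (b := decide (IsHeavy G r i)) (k := 4)
    (x := do
      let H ← op (G.get i :: p.1)
      pure (H, p.2))
    (y := do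
      let k ← op (Nat.log 2 (G.get i).weight)
      let l ← op (p.2 k)
      let l' ← op (G.get i :: l)
      let B ← op (Function.update p.2 k l')
      pure (p.1, B)) (by simp) (by simp)
  have h8 : 1 + (1 + (1 + (1 + (1 + (1 + (1 + (1 + (if decide (IsHeavy G r i) then (do
      let H ← op (G.get i :: p.1)
      pure (H, p.2) : Timed (List (Arc n) × (ℕ → List (Arc n))))
    else do
      let k ← op (Nat.log 2 (G.get i).weight)
      let l ← op (p.2 k)
      let l' ← op (G.get i :: l)
      let B ← op (Function.update p.2 k l')
      pure (p.1, B)).steps))))))) ≤ 12 := by omega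
  exact h8

lemma sum_map_range {M : Type*} [AddCommMonoid M] (f : ℕ → M) (s : ℕ) :
    ((List.range s).map f).sum = ∑ k ∈ Finset.range s, f k := by
  induction s with
  | zero => rfl
  | succ s ih => simp [List.range_succ, Finset.sum_range_succ, ih]

lemma foldl_splitStep_heavy (G : DiGraph n) (r : Fin G.length → ℝ)
    (xs : List (Fin G.length))
    (p : List (Arc n) × (ℕ → List (Arc n))) :
    (xs.foldl (splitStep G r) p).1.length = p.1.length + xs.countP (IsHeavy G r ·) := by
  induction xs generalizing p with
  | nil => simp
  | cons i xs ih =>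
    rw [List.foldl_cons, ih, List.countP_cons]
    by_cases h : IsHeavy G r i
    · simp [splitStep_of_heavy h, h]; ring
    · simp [splitStep_of_not_heavy h, h]

lemma foldl_splitStep_light (G : DiGraph n) (r : Fin G.length → ℝ) (xs : List (Fin G.length))
    (p : List (Arc n) × (ℕ → List (Arc n)))
    (hp : ∀ k, ∀ e ∈ p.2 k, Nat.log 2 e.weight = k ∧ ∃ i, G.get i = e ∧ ¬ IsHeavy G r i) (k : ℕ) :
    ∀ e ∈ (xs.foldl (splitStep G r) p).2 k,
      Nat.log 2 e.weight = k ∧ ∃ i, G.get i = e ∧ ¬ IsHeavy G r i := by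
  induction xs generalizing p with
  | nil => exact hp k
  | cons i xs ih =>
    rw [List.foldl_cons]
    refine ih _ fun k e he => ?_
    by_cases h : IsHeavy G r i
    · rw [splitStep_of_heavy h] at he
      exact hp k e he
    · rw [splitStep_of_not_heavy h] at he
      by_cases hk : k = Nat.log 2 (G.get i).weight
      · subst hk
        simp only [Function.update_self] at he
        rcases List.mem_cons.1 he with rfl | he
        · exact ⟨rfl, i, rfl, h⟩
        · exact hp _ e he
      · simp only [Function.update_of_ne hk] at he
        exact hp k e he

/-- Loop invariant: a step moves one arc either to the heavy list or to one bucket. The bound `s` on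
the exponents ensures that this bucket is among those summed. -/
lemma foldl_splitStep_total (G : DiGraph n) (r : Fin G.length → ℝ) {s : ℕ}
    (hs : ∀ e ∈ G, Nat.log 2 e.weight < s) (xs : List (Fin G.length))
    (p : List (Arc n) × (ℕ → List (Arc n))) :
    ((xs.foldl (splitStep G r) p).1 : Multiset (Arc n)) +
        ((List.range s).map fun k =>
          ((xs.foldl (splitStep G r) p).2 k : Multiset (Arc n))).sum =
      (p.1 : Multiset (Arc n)) + ((List.range s).map fun k => (p.2 k : Multiset (Arc n))).sum +
        (xs.map G.get : List (Arc n)) := by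
  induction xs generalizing p with
  | nil => simp
  | cons i xs ih =>
    rw [List.foldl_cons, ih, List.map_cons, ← Multiset.cons_coe, ← Multiset.singleton_add,
      ← add_assoc]
    congr 1
    by_cases h : IsHeavy G r i
    · rw [splitStep_of_heavy h, ← Multiset.cons_coe, ← Multiset.singleton_add]
      exact (add_assoc _ _ _).trans (add_comm _ _)
    · rw [splitStep_of_not_heavy h, add_assoc, sum_map_range, sum_map_range]
      congr 1
      have hk := hs _ (List.get_mem G i)
      rw [← Finset.add_sum_erase _ _ (Finset.mem_range.2 hk),
        ← Finset.add_sum_erase _ _ (Finset.mem_range.2 hk)]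
      simp only [Function.update_self]
      rw [← Multiset.cons_coe, ← Multiset.singleton_add, add_assoc, add_comm]
      congr 2
      refine Finset.sum_congr rfl fun k hk' => ?_
      rw [Function.update_of_ne (Finset.ne_of_mem_erase hk')]

/-- The arc `e` occurs at a position at which it is not heavy. -/
def IsLight (G : DiGraph n) (r : Fin G.length → ℝ) (e : Arc n) : Prop :=
  ∃ i, G.get i = e ∧ ¬ IsHeavy G r i

/-- The joint distribution of the output of one round and its number of steps. -/
theorem cycleSparsifyOnce_run {CD : CycleAlg n} {mhat L θ : ℕ} {T : ℕ → ℕ}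
    (hCD : IsShortCycleAlg CD mhat L T) {G : DiGraph n} (hl : Loopless G) (hp : PowTwoWeights G)
    (r : Fin G.length → ℝ) :
    ∃ (ι : Type) (_ : Fintype ι) (_ : DecidableEq ι) (B : Multiset (Arc n))
      (Z : ι → OrientedCycle n) (g : (ι → Bool) → List (Arc n) × ℕ),
      (cycleSparsifyOnce CD θ G r).dist = PMF.map g (PMF.uniformOfFintype (ι → Bool)) ∧
      (∀ σ, ((g σ).1 : Multiset (Arc n)) =
        B + ∑ i, (if σ i then (Z i).cw else (Z i).ccw).map Arc.double) ∧
      (G : Multiset (Arc n)) = B + ∑ i, ((Z i).cw + (Z i).ccw) ∧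
      (∀ i, (Z i).Valid L) ∧
      Multiset.card B ≤ (List.finRange G.length).countP (IsHeavy G r ·) +
        (numClasses G).val * (θ + mhat) ∧
      (∀ i, ∀ e ∈ (Z i).cw + (Z i).ccw, IsLight G r e) ∧
      (Monotone T → SuperAdditiveFrom θ T → ∀ σ,
        (g σ).2 ≤ 37 * G.length + 8 * (numClasses G).val + 2 + T G.length) := by
  set s := (numClasses G).val with hs
  set p := (split G r fun _ => []).val with hpdef
  have hpval : p = (List.finRange G.length).foldl (splitStep G r) ([], fun _ => []) :=
    split_val G r _
  have hlight : ∀ k, ∀ e ∈ p.2 k, Nat.log 2 e.weight = k ∧ IsLight G r e := by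
    rw [hpval]
    exact foldl_splitStep_light G r _ _ (by simp)
  have hmem : ∀ k, ∀ e ∈ p.2 k, e ∈ G := by
    rintro k e he
    obtain ⟨-, i, rfl, -⟩ := hlight k e he
    exact List.get_mem _ _
  have hheavy : p.1.length = (List.finRange G.length).countP (IsHeavy G r ·) := by
    rw [hpval, foldl_splitStep_heavy]
    simp
  have htotal : (p.1 : Multiset (Arc n)) +
      ((List.range s).map fun k => (p.2 k : Multiset (Arc n))).sum = G := by
    rw [hpval, foldl_splitStep_total G r (fun e he => log_weight_lt_numClasses he),
      List.map_get_finRange]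
    simp
  have hlen : p.1.length + ((List.range s).map fun k => (p.2 k).length).sum = G.length := by
    have := congrArg Multiset.card htotal
    rw [Multiset.card_add, sum_map_range, Multiset.card_sum] at this
    rw [sum_map_range]
    simpa using this
  -- Since the weights are powers of two, the logarithm recorded by the bucket determines the weight
  -- exactly.
  have hclass := fun k => (sparsifyClass_samples (θ := θ) hCD (l := p.2 k) (w := 2 ^ k)
    (fun e he => by
      obtain ⟨j, hj⟩ := hp e (hmem k e he)
      have := (hlight k e he).1
      rw [hj, Nat.log_pow Nat.one_lt_two] at this
      rw [hj, this]) fun e he => hl e (hmem k e he))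
  have hfold := SamplesCycles.foldlM (L := L) (xs := List.range s)
    (f := fun (H : List (Arc n)) i => (do
      liftM tick
      let l ← (liftM (op (p.2 i)) : RandTimed _)
      sparsifyClass CD θ H l))
    (l := fun k => (p.2 k : Multiset (Arc n))) (b := fun _ => θ + mhat)
    fun k _ => SamplesCycles.lift_bind (SamplesCycles.lift_bind (hclass k))
  obtain ⟨ι, i1, i2, B, Z, hB, hb, hZ, hrun⟩ := hfold
  obtain ⟨g, hg, hg'⟩ := hrun p.1
  refine ⟨ι, i1, i2, p.1 + B, Z, fun σ => ((g σ).1, (numClasses G).steps + ((s + 1) +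
    ((split G r fun _ => []).steps + (g σ).2))), ?_, fun σ => (hg' σ).1, ?_, hZ, ?_, ?_, ?_⟩
  · have h1 := RandTimed.dist_lift_bind (numClasses G) fun s => (do
      let B₀ ← (liftM (emptyBuckets s) : RandTimed (ℕ → List (Arc n)))
      let p ← (liftM (split G r B₀) : RandTimed _)
      (List.range s).foldlM (fun H i => (do
        liftM tick
        let l ← (liftM (op (p.2 i)) : RandTimed _)
        sparsifyClass CD θ H l)) p.1)
    refine Eq.trans h1 ?_
    rw [RandTimed.dist_lift_bind, RandTimed.dist_lift_bind]
    refine Eq.trans (congrArg (fun d => PMF.map _ (PMF.map _ (PMF.map _ d))) hg) ?_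
    rw [PMF.map_comp, PMF.map_comp, PMF.map_comp]
    rfl
  · rw [← htotal, hB, add_assoc]
  · rw [Multiset.card_add, Multiset.coe_card, hheavy]
    refine Nat.add_le_add_left (hb.trans ?_) _
    simp
  · intro i e he
    have : e ∈ ((List.range s).map fun k => (p.2 k : Multiset (Arc n))).sum := by
      rw [hB]
      exact Multiset.mem_add.2 (Or.inr (Multiset.mem_sum.2 ⟨i, Finset.mem_univ i, he⟩))
    rw [sum_map_range, Multiset.mem_sum] at this
    obtain ⟨k, -, hk⟩ := this
    exact (hlight k e hk).2
  · intro hmono hsup σ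
    have h1 := (hg' σ).2
    have h2 := numClasses_steps_le G
    have h3 := split_steps_le G r fun _ => []
    -- Only classes with at least `θ` arcs call the decomposition algorithm, so super-additivity
    -- applies to them; discarding the others is compensated by monotonicity.
    have hT : ((List.range s).map fun k =>
        if θ ≤ (p.2 k).length then T (p.2 k).length else 0).sum ≤ T G.length := by
      have e1 : ∀ ks : List ℕ, (ks.map fun k =>
          if θ ≤ (p.2 k).length then T (p.2 k).length else 0).sum =
          (((ks.map fun k => (p.2 k).length).filter fun x => θ ≤ x).map T).sum := by
        intro ks
        induction ks with
        | nil => rfl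
        | cons k ks ih => by_cases h : θ ≤ (p.2 k).length <;> simp [h, ih]
      have e2 : ∀ ks : List ℕ, (ks.filter fun x => θ ≤ x).sum ≤ ks.sum := by
        intro ks
        induction ks with
        | nil => exact le_rfl
        | cons k ks ih => by_cases h : θ ≤ k <;> simp [h] <;> omega
      rw [e1]
      refine (hsup _ fun x hx => by simpa using (List.mem_filter.1 hx).2).trans (hmono ?_)
      have := e2 ((List.range s).map fun k => (p.2 k).length)
      omega
    have hsum : ((List.range s).map fun k => tick.steps + ((op (p.2 k)).steps +
        (5 + 21 * (p.2 k).length + if θ ≤ (p.2 k).length then T (p.2 k).length else 0))).sum =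
        7 * s + 21 * ((List.range s).map fun k => (p.2 k).length).sum +
        ((List.range s).map fun k =>
          if θ ≤ (p.2 k).length then T (p.2 k).length else 0).sum := by
      simp only [sum_map_range, Finset.mul_sum, tick_steps, op_steps]
      rw [show 7 * s = ∑ k ∈ Finset.range s, 7 by simp [mul_comm], ← Finset.sum_add_distrib,
        ← Finset.sum_add_distrib]
      exact Finset.sum_congr rfl fun k _ => by omega
    rw [hsum] at h1
    -- The coefficient 37 is 4 for counting classes, 12 for splitting and 21 for processing; each
    -- class costs 1 for its bucket and 7 for its round.
    show (numClasses G).steps + ((s + 1) + ((split G r fun _ => []).steps + (g σ).2)) ≤ _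
    omega

end Run
end CycleSparsify
namespace CycleSparsify
open Matrix

/-! ### The output of one round -/

section Output
variable {n : ℕ}

lemma opNorm_le_sqrt {A : Matrix (Fin n) (Fin n) ℝ} {t : ℝ}
    (h : ∀ y : Fin n → ℝ, (A *ᵥ y) ⬝ᵥ (A *ᵥ y) ≤ t * (y ⬝ᵥ y)) : opNorm A ≤ √t := by
  have hsq (x : EuclideanSpace ℝ (Fin n)) : ‖x‖ ^ 2 = x.ofLp ⬝ᵥ x.ofLp := by
    rw [EuclideanSpace.real_norm_sq_eq, dotProduct]
    exact Finset.sum_congr rfl fun i _ => sq _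
  refine ContinuousLinearMap.opNorm_le_bound _ (Real.sqrt_nonneg _) fun x => ?_
  have h1 : ‖Matrix.toEuclideanCLM (𝕜 := ℝ) A x‖ ^ 2 ≤ t * ‖x‖ ^ 2 := by
    rw [hsq, hsq, Matrix.ofLp_toEuclideanCLM]
    exact h _
  rw [← Real.sqrt_sq (norm_nonneg (Matrix.toEuclideanCLM (𝕜 := ℝ) A x))]
  refine (Real.sqrt_le_sqrt h1).trans (le_of_eq ?_)
  rw [mul_comm, Real.sqrt_mul (sq_nonneg _), Real.sqrt_sq (norm_nonneg _), mul_comm]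

open Classical in
lemma ofReal_le_prob {α ι : Type} [Fintype ι] [DecidableEq ι] {x : RandTimed α}
    {g : (ι → Bool) → α × ℕ} (hx : x.dist = PMF.map g (PMF.uniformOfFintype (ι → Bool)))
    {P : α → Prop} {δ : ℝ}
    {bad : Finset (ι → Bool)} (hP : ∀ σ, σ ∉ bad → P (g σ).1)
    (h : (bad.card : ℝ) ≤ δ * 2 ^ Fintype.card ι) :
    ENNReal.ofReal (1 - δ) ≤ x.prob P := by
  have e : x.prob P = (Fintype.card (g ⁻¹' {p | P p.1}) : ENNReal) /
      (Fintype.card (ι → Bool) : ENNReal) := by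
    show PMF.toOuterMeasure x.dist _ = _
    rw [hx, PMF.toOuterMeasure_map_apply, PMF.toOuterMeasure_uniformOfFintype_apply]
  have hcard : Fintype.card (g ⁻¹' {p | P p.1}) =
      (Finset.univ.filter fun σ => P (g σ).1).card := by
    rw [Fintype.card_subtype]
    rfl
  have hsum := Finset.card_filter_add_card_filter_not (s := Finset.univ)
    (fun σ : ι → Bool => P (g σ).1)
  rw [Finset.card_univ, Fintype.card_fun, Fintype.card_bool] at hsum
  have hpos : (0 : ℝ) < 2 ^ Fintype.card ι := by positivity
  rw [e, hcard, Fintype.card_fun, Fintype.card_bool, ← ENNReal.ofReal_natCast,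
    ← ENNReal.ofReal_natCast (2 ^ Fintype.card ι), ← ENNReal.ofReal_div_of_pos (by positivity)]
  refine ENNReal.ofReal_le_ofReal ?_
  have hsum' : ((Finset.univ.filter fun σ => P (g σ).1).card : ℝ) +
      (Finset.univ.filter fun σ => ¬ P (g σ).1).card = 2 ^ Fintype.card ι := by
    exact_mod_cast hsum
  have hsub : ((Finset.univ.filter fun σ => ¬ P (g σ).1).card : ℝ) ≤ bad.card := by
    refine Nat.cast_le.2 (Finset.card_le_card fun σ hσ => ?_)
    by_contra hcon
    exact (Finset.mem_filter.1 hσ).2 (hP σ hcon)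
  push_cast
  rw [le_div_iff₀ hpos]
  linarith

lemma arcFlow_double (e : Arc n) : arcFlow e.double = (2 : ℝ) • arcFlow e := by
  simp [arcFlow, Arc.double, smul_smul]

lemma arcLap_double (e : Arc n) : arcLap e.double = (2 : ℝ) • arcLap e := by
  simp [arcLap, Arc.double, smul_smul]

/-- With at least two vertices, every vertex must have an outgoing arc. -/
lemma card_le_length (hn : 2 ≤ n) {G : DiGraph n} (hC : StronglyConnected G) :
    n ≤ G.length := by
  have hout : ∀ u : Fin n, u ∈ (G.map Arc.tail).toFinset := by
    intro u
    have : Nontrivial (Fin n) := Fin.nontrivial_iff_two_le.2 hn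
    obtain ⟨v, hv⟩ := exists_ne u
    rcases Relation.ReflTransGen.cases_head (hC u v) with h | ⟨w, ⟨e, he, h1, -⟩, -⟩
    · exact absurd h.symm hv
    · rw [List.mem_toFinset, List.mem_map]
      exact ⟨e, he, h1⟩
  have h := (G.map Arc.tail).toFinset_card_le
  rw [Finset.eq_univ_iff_forall.2 hout, Finset.card_univ, Fintype.card_fin, List.length_map] at h
  exact h

/-- A short cycle decomposition algorithm must allow cycles of positive length. -/
lemma IsShortCycleAlg.length_pos (hn : 2 ≤ n) {CD : CycleAlg n} {mhat L : ℕ} {T : ℕ → ℕ}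
    (h : IsShortCycleAlg CD mhat L T) : 0 < L := by
  by_contra hL
  have hL0 : L = 0 := by omega
  -- If no nonempty cycle were allowed, all of `mhat + 1` parallel edges would be left over.
  obtain ⟨⟨hperm, hcyc, hrest⟩, -⟩ := h (mhat + 1)
    (fun _ => s(⟨0, by omega⟩, ⟨1, by omega⟩)) (fun _ => by simp)
  have hnil : (CD (mhat + 1) fun _ => s(⟨0, by omega⟩, ⟨1, by omega⟩)).val.cycles = [] := by
    refine List.eq_nil_iff_forall_not_mem.2 fun C hC => ?_
    have h1 := (hcyc C hC).1.1
    have h2 := (hcyc C hC).2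
    rw [hL0, Nat.le_zero, List.length_eq_zero_iff] at h2
    exact h1 h2
  rw [hnil] at hperm
  have := hperm.length_eq
  simp at this
  omega

lemma sum_coe_map {M : Type*} [AddCommMonoid M] (l : List (Arc n)) (f : Arc n → M) :
    (l.map f).sum = ((l : Multiset (Arc n)).map f).sum := by
  rw [Multiset.map_coe, Multiset.sum_coe]

lemma sum_map_finset_sum {M ι : Type*} [AddCommMonoid M] (t : Finset ι)
    (s : ι → Multiset (Arc n)) (f : Arc n → M) :
    ((∑ i ∈ t, s i).map f).sum = ∑ i ∈ t, ((s i).map f).sum :=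
  map_sum (Multiset.sumAddMonoidHom.comp (Multiset.mapAddMonoidHom f)) s t

lemma sum_map_smul {M : Type*} [AddCommMonoid M] [Module ℝ M] (c : ℝ) (s : Multiset (Arc n))
    (f : Arc n → M) : (s.map fun e => c • f e).sum = c • (s.map f).sum := by
  rw [Multiset.smul_sum, Multiset.map_map]
  rfl

/-! ### Additive quantities of the input and of the output -/

section Decomposition
variable {ι : Type} [Fintype ι] {B : Multiset (Arc n)} {Z : ι → OrientedCycle n} {G : DiGraph n}

lemma sum_input {M : Type*} [AddCommMonoid M]
    (hG : (G : Multiset (Arc n)) = B + ∑ i, ((Z i).cw + (Z i).ccw)) (f : Arc n → M) :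
    (G.map f).sum = (B.map f).sum + ∑ i, ((((Z i).cw).map f).sum + (((Z i).ccw).map f).sum) := by
  rw [sum_coe_map, hG, Multiset.map_add, Multiset.sum_add, sum_map_finset_sum]
  simp only [Multiset.map_add, Multiset.sum_add]

lemma sum_output {M : Type*} [AddCommMonoid M] {H : List (Arc n)} {σ : ι → Bool}
    (hH : (H : Multiset (Arc n)) =
      B + ∑ i, (if σ i then (Z i).cw else (Z i).ccw).map Arc.double) (f : Arc n → M) :
    (H.map f).sum = (B.map f).sum +
      ∑ i, if σ i then (((Z i).cw).map fun e => f e.double).sum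
        else (((Z i).ccw).map fun e => f e.double).sum := by
  rw [sum_coe_map, hH, Multiset.map_add, Multiset.sum_add, sum_map_finset_sum]
  congr 1
  refine Finset.sum_congr rfl fun i _ => ?_
  split_ifs <;> rw [Multiset.map_map] <;> rfl

/-- Clockwise and counter-clockwise flows agree, so twice either one is their sum. -/
lemma output_isEulerian {L : ℕ} (hE : IsEulerian G) (hZ : ∀ i, (Z i).Valid L)
    (hG : (G : Multiset (Arc n)) = B + ∑ i, ((Z i).cw + (Z i).ccw)) {H : List (Arc n)}
    {σ : ι → Bool} (hH : (H : Multiset (Arc n)) =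
      B + ∑ i, (if σ i then (Z i).cw else (Z i).ccw).map Arc.double) : IsEulerian H := by
  rw [isEulerian_iff] at hE ⊢
  rw [← hE, sum_output hH, sum_input hG]
  congr 1
  refine Finset.sum_congr rfl fun i _ => ?_
  simp only [arcFlow_double, sum_map_smul]
  split_ifs
  · rw [← (hZ i).flow, two_smul]
  · rw [(hZ i).flow, two_smul]

lemma output_powTwoWeights (hp : PowTwoWeights G)
    (hG : (G : Multiset (Arc n)) = B + ∑ i, ((Z i).cw + (Z i).ccw)) {H : List (Arc n)}
    {σ : ι → Bool} (hH : (H : Multiset (Arc n)) =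
      B + ∑ i, (if σ i then (Z i).cw else (Z i).ccw).map Arc.double) : PowTwoWeights H := by
  have hp' : ∀ e ∈ (G : Multiset (Arc n)), ∃ k : ℕ, e.weight = 2 ^ k := hp
  rw [hG] at hp'
  intro e he
  rw [← Multiset.mem_coe, hH] at he
  rcases Multiset.mem_add.1 he with he | he
  · exact hp' e (Multiset.mem_add.2 (Or.inl he))
  · obtain ⟨i, -, he⟩ := Multiset.mem_sum.1 he
    obtain ⟨e', he', rfl⟩ := Multiset.mem_map.1 he
    obtain ⟨k, hk⟩ := hp' e' (Multiset.mem_add.2 (Or.inr (Multiset.mem_sum.2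
      ⟨i, Finset.mem_univ i, Multiset.mem_add.2 (by split_ifs at he' <;> simp [he'])⟩)))
    exact ⟨k + 1, by rw [Arc.double, hk, pow_succ']⟩

/-- Both directions minus twice the chosen one is, up to sign, the difference of the directions; the
coin is that sign. -/
lemma dirLaplacian_sub_output
    (hG : (G : Multiset (Arc n)) = B + ∑ i, ((Z i).cw + (Z i).ccw)) {H : List (Arc n)}
    {σ : ι → Bool} (hH : (H : Multiset (Arc n)) =
      B + ∑ i, (if σ i then (Z i).cw else (Z i).ccw).map Arc.double) :
    dirLaplacian G - dirLaplacian H = -∑ i, sgn (σ i) • (Z i).mat := by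
  rw [dirLaplacian_eq_sum, dirLaplacian_eq_sum, sum_output hH, sum_input hG,
    add_sub_add_left_eq_sub, ← Finset.sum_sub_distrib, ← Finset.sum_neg_distrib]
  refine Finset.sum_congr rfl fun i _ => ?_
  simp only [arcLap_double, sum_map_smul]
  rw [OrientedCycle.mat, ← OrientedCycle.sum_cw_sub_sum_ccw]
  cases σ i <;> simp [sgn, two_smul]

/-- Exactly half of the arcs on cycles survive on average; the last sum is the mean-zero
fluctuation. -/
lemma two_mul_length_output
    (hG : (G : Multiset (Arc n)) = B + ∑ i, ((Z i).cw + (Z i).ccw)) {H : List (Arc n)}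
    {σ : ι → Bool} (hH : (H : Multiset (Arc n)) =
      B + ∑ i, (if σ i then (Z i).cw else (Z i).ccw).map Arc.double) :
    2 * (H.length : ℝ) = Multiset.card B + G.length +
      ∑ i, sgn (σ i) * ((Multiset.card (Z i).cw : ℝ) - Multiset.card (Z i).ccw) := by
  have h1 := sum_input hG fun _ => (1 : ℝ)
  have h2 := sum_output hH fun _ => (1 : ℝ)
  simp only [List.map_const', List.sum_replicate, Multiset.map_const', Multiset.sum_replicate,
    nsmul_eq_mul, mul_one] at h1 h2
  rw [h1, h2, mul_add, Finset.mul_sum, two_mul, add_assoc, add_assoc, add_assoc]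
  congr 2
  rw [← Finset.sum_add_distrib]
  refine Finset.sum_congr rfl fun i _ => ?_
  cases σ i <;> simp [sgn] <;> ring

lemma sum_arcs_le (hG : (G : Multiset (Arc n)) = B + ∑ i, ((Z i).cw + (Z i).ccw))
    {f : Arc n → ℝ} (hf : ∀ e, 0 ≤ f e) : ∑ i, ∑ j, f ((Z i).arc j) ≤ (G.map f).sum := by
  rw [sum_input hG]
  simp only [OrientedCycle.sum_cw_add_sum_ccw]
  refine le_add_of_nonneg_left (Multiset.sum_nonneg fun x hx => ?_)
  obtain ⟨e, -, rfl⟩ := Multiset.mem_map.1 hx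
  exact hf e

end Decomposition

/-! ### Heavy and light arcs -/

/-- At most half of the arcs are heavy. -/
lemma two_mul_countP_heavy_le (hn : 2 ≤ n) {G : DiGraph n} (hE : IsEulerian G)
    {r : Fin G.length → ℝ} (hr : ApproxEffRes 2 G r) :
    2 * ((List.finRange G.length).countP (IsHeavy G r ·) : ℝ) ≤ G.length := by
  rcases Nat.eq_zero_or_pos G.length with h0 | h0
  · have := List.countP_le_length (p := fun i => decide (IsHeavy G r i))
      (l := List.finRange G.length)
    rw [List.length_finRange] at this
    have h1 : ((List.finRange G.length).countP (IsHeavy G r ·) : ℝ) ≤ G.length := by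
      exact_mod_cast this
    have h2 : (G.length : ℝ) = 0 := by exact_mod_cast h0
    linarith
  have hm : (0 : ℝ) < G.length := by exact_mod_cast h0
  have hn0 : (0 : ℝ) < n := by exact_mod_cast (by omega : 0 < n)
  -- The overestimate by 2 in `r` cancels the half weight. As `∑ w R ≤ 2n`, at most `m / 2` arcs can
  -- reach `4n / m`.
  have hterm (i : Fin G.length) (hi : IsHeavy G r i) : 4 * (n : ℝ) / G.length ≤
      ((G.get i).weight : ℝ) * effRes G (G.get i).tail (G.get i).head := by
    have h1 := (hr i).2
    have hw : (0 : ℝ) ≤ (G.get i).weight := Nat.cast_nonneg _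
    rw [IsHeavy] at hi
    nlinarith
  have hcount : ∀ xs : List (Fin G.length), (xs.countP (IsHeavy G r ·) : ℝ) *
      (4 * (n : ℝ) / G.length) ≤
      (xs.map fun i => ((G.get i).weight : ℝ) * effRes G (G.get i).tail (G.get i).head).sum := by
    intro xs
    induction xs with
    | nil => simp
    | cons i xs ih =>
      rw [List.countP_cons, List.map_cons, List.sum_cons]
      by_cases hi : IsHeavy G r i
      · have := hterm i hi
        simp only [hi, decide_true, if_true]
        push_cast
        linarith
      · have : 0 ≤ ((G.get i).weight : ℝ) * effRes G (G.get i).tail (G.get i).head :=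
          mul_nonneg (Nat.cast_nonneg _) (effRes_nonneg hE _ _)
        simp only [hi, decide_false, Bool.false_eq_true, if_false, add_zero]
        linarith
  have h := (hcount (List.finRange G.length)).trans (le_of_eq_of_le ?_ (sum_weight_mul_effRes_le hE))
  · rw [mul_div_assoc', div_le_iff₀ hm] at h
    nlinarith
  · conv_rhs => rw [← List.map_get_finRange G]
    rw [List.map_map]
    simp [Function.comp_def]

/-- The constant 16 is the threshold 4, times 2 for the half weight, times 2 for the approximation
of the resistance. -/
lemma weight_mul_effRes_le_of_light {G : DiGraph n} {r : Fin G.length → ℝ}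
    (hr : ApproxEffRes 2 G r) {e : Arc n} (he : IsLight G r e) :
    (e.weight : ℝ) * effRes G e.tail e.head ≤ 16 * n / G.length := by
  obtain ⟨i, rfl, hi⟩ := he
  rw [IsHeavy, not_lt] at hi
  have h1 := (hr i).1
  have hw : (0 : ℝ) ≤ (G.get i).weight := Nat.cast_nonneg _
  have : 16 * (n : ℝ) / G.length = 4 * (4 * n / G.length) := by ring
  rw [this]
  nlinarith

end Output
end CycleSparsify
namespace CycleSparsify
open Matrix

/-! ### Choice of parameters and the high-probability bounds -/

section Probability
variable {n : ℕ}

/-- Rounding up `(c + 3) log n` costs at most one more `log n`. The prefactor `2n + 1` counts the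
dilated matrix series and the scalar sum, and is at most `n³` for `n ≥ 2`. -/
lemma exists_sample_size {c : ℝ} (hc : 0 < c) (hn : 2 ≤ n) :
    ∃ p : ℕ, p ≠ 0 ∧ (p : ℝ) ≤ (c + 4) * Real.logb 2 n ∧
      (2 * n + 1) * (1 / 2 : ℝ) ^ p ≤ (n : ℝ) ^ (-c) := by
  have hn2 : (2 : ℝ) ≤ n := by exact_mod_cast hn
  have hlg : 1 ≤ Real.logb 2 n := by
    rw [Real.le_logb_iff_rpow_le (by norm_num) (by linarith)]
    simpa using hn2
  have hpos : 0 < (c + 3) * Real.logb 2 n := by positivity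
  refine ⟨⌈(c + 3) * Real.logb 2 n⌉₊, (Nat.ceil_pos.2 hpos).ne', ?_, ?_⟩
  · have := (Nat.ceil_lt_add_one hpos.le).le
    linarith
  · have h1 : (1 / 2 : ℝ) ^ ⌈(c + 3) * Real.logb 2 n⌉₊ ≤ (n : ℝ) ^ (-(c + 3)) := by
      rw [← Real.rpow_natCast, one_div, Real.inv_rpow (by norm_num), ← Real.rpow_neg (by norm_num)]
      have h2 : (n : ℝ) ^ (-(c + 3)) = (2 : ℝ) ^ (-((c + 3) * Real.logb 2 n)) := by
        conv_lhs => rw [← Real.rpow_logb (b := 2) (by norm_num) (by norm_num)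
          (show (0 : ℝ) < n by linarith)]
        rw [← Real.rpow_mul (by norm_num)]
        congr 1; ring
      rw [h2]
      exact Real.rpow_le_rpow_of_exponent_le (by norm_num) (neg_le_neg (Nat.le_ceil _))
    have h3 : (n : ℝ) ^ (-c) = (n : ℝ) ^ 3 * (n : ℝ) ^ (-(c + 3)) := by
      rw [← Real.rpow_natCast, ← Real.rpow_add (by linarith)]
      congr 1; push_cast; ring
    have h4 : (2 * n + 1 : ℝ) ≤ (n : ℝ) ^ 3 := by nlinarith [mul_le_mul hn2 hn2 (by norm_num) (by linarith)]
    rw [h3]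
    gcongr

/-- The number of weight classes is logarithmic. -/
lemma numClasses_val_le_of_weight_le {G : DiGraph n} {a : ℕ} (h : ∀ e ∈ G, e.weight ≤ n ^ a) :
    (numClasses G).val ≤ Nat.log 2 (n ^ a) + 1 :=
  numClasses_val_le fun e he => Nat.log_mono_right (h e he)

open Classical in
/-- With high probability the output of one round is sparse and a good approximation. -/
theorem cycleSparsifyOnce_prob {a : ℕ} {c : ℝ} (hc : 0 < c) (hn : 2 ≤ n) {mhat L θ : ℕ}
    {T : ℕ → ℕ} {CD : CycleAlg n} (hCD : IsShortCycleAlg CD mhat L T) (hθ : θ ≤ n)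
    {G : DiGraph n} {r : Fin G.length → ℝ} (hl : Loopless G) (hC : StronglyConnected G)
    (hE : IsEulerian G) (hp : PowTwoWeights G) (ha : ∀ e ∈ G, e.weight ≤ n ^ a)
    (hr : ApproxEffRes 2 G r)
    (hm : (16 * (a + 1) + 41 * (c + 4)) *
      ((mhat : ℝ) * Real.logb 2 n + (n : ℝ) * (L : ℝ) ^ 2 * Real.logb 2 n) ≤ (G.length : ℝ)) :
    ENNReal.ofReal (1 - (n : ℝ) ^ (-c)) ≤ (cycleSparsifyOnce CD θ G r).prob fun H =>
      (H.length : ℝ) ≤ 15 / 16 * (G.length : ℝ) ∧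
      approxError G H ≤ √(512 * (c + 4)) *
        √((n : ℝ) * (L : ℝ) ^ 2 * Real.logb 2 n / (G.length : ℝ)) := by
  obtain ⟨ι, _, _, B, Z, g, hdist, hout, hG, hZ, hB, hlight, -⟩ :=
    cycleSparsifyOnce_run (θ := θ) hCD hl hp r
  obtain ⟨p, hp0, hpub, hpδ⟩ := exists_sample_size hc hn
  have hn2 : (2 : ℝ) ≤ n := by exact_mod_cast hn
  have hn0 : (0 : ℝ) < n := by linarith
  have hL1 : (1 : ℝ) ≤ L := by exact_mod_cast hCD.length_pos hn
  have hL0 : (0 : ℝ) < L := by linarith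
  set lg := Real.logb 2 n with hlgdef
  have hlg : 1 ≤ lg := by
    rw [hlgdef, Real.le_logb_iff_rpow_le (by norm_num) hn0]
    simpa using hn2
  have hlg0 : 0 < lg := by linarith
  set m : ℝ := (G.length : ℝ) with hmdef
  have hm0 : 0 < m := by
    have := hn.trans (card_le_length hn hC)
    rw [hmdef]
    exact_mod_cast (by omega : 0 < G.length)
  have hp1 : (0 : ℝ) < p := by exact_mod_cast Nat.pos_of_ne_zero hp0
  have hw : ∀ e ∈ G, 0 < e.weight := fun e he => by
    obtain ⟨k, hk⟩ := hp e he
    rw [hk]; positivity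
  set S := pinvSqrt (undirLaplacian G) with hS
  -- the two exceptional events
  have hvar := cycles_variance_le hE hC hw hZ (ρ := 16 * n / m) (by positivity)
    (fun i j => weight_mul_effRes_le_of_light hr (hlight i _ (by
      rw [Multiset.mem_add, OrientedCycle.cw, OrientedCycle.ccw, Multiset.mem_map,
        Multiset.mem_map]
      by_cases h : (Z i).fwd j = true
      · exact Or.inl ⟨j, by simpa using h, rfl⟩
      · exact Or.inr ⟨j, by simpa using h, rfl⟩))) (fun f hf => sum_arcs_le hG hf)
  have hbad₁ := card_signSum_large_le' (B := fun i => S * (Z i).mat * S)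
    (v := 8 * ((L : ℝ) ^ 2 * (16 * n / m))) (by positivity) (fun y => (hvar y).1)
    (fun y => (hvar y).2) hp0
  have hlenle : ∑ i, ((Z i).len : ℝ) ≤ m := by
    have := sum_arcs_le hG (f := fun _ => 1) fun _ => zero_le_one
    simpa using this
  -- Each difference of counts is at most the length of its cycle, and the squared lengths sum to at
  -- most `L` times the number of arcs.
  have hbad₂ := card_sum_sgn_large_le
    (x := fun i => (Multiset.card (Z i).cw : ℝ) - Multiset.card (Z i).ccw) (v := L * m)
    (by positivity) (by
      refine le_trans (Finset.sum_le_sum fun i _ => ?_) (by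
        rw [← Finset.mul_sum]
        exact mul_le_mul_of_nonneg_left hlenle hL0.le)
      have h1 : ((Z i).len : ℝ) = Multiset.card (Z i).cw + Multiset.card (Z i).ccw := by
        exact_mod_cast (Z i).card_cw_add_card_ccw.symm
      have h2 : ((Z i).len : ℝ) ≤ L := by exact_mod_cast (hZ i).len_le
      have h3 : (0 : ℝ) ≤ Multiset.card (Z i).cw := Nat.cast_nonneg _
      have h4 : (0 : ℝ) ≤ Multiset.card (Z i).ccw := Nat.cast_nonneg _
      have h5 : (0 : ℝ) ≤ (Z i).len := Nat.cast_nonneg _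
      calc ((Multiset.card (Z i).cw : ℝ) - Multiset.card (Z i).ccw) ^ 2
          ≤ ((Z i).len : ℝ) * (Z i).len := by rw [h1]; nlinarith
        _ ≤ L * (Z i).len := mul_le_mul_of_nonneg_right h2 h5) hp0
  rw [Fintype.card_fin] at hbad₁
  -- the arithmetic of the parameters
  have hmL : 41 * (c + 4) * (n * L ^ 2 * lg) ≤ m := by
    refine le_trans ?_ hm
    have : 0 ≤ (mhat : ℝ) * lg := by positivity
    have h2 : 0 ≤ n * (L : ℝ) ^ 2 * lg := by positivity
    have h3 : (0 : ℝ) ≤ 16 * (a + 1) := by positivity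
    nlinarith
  have hma : 16 * (a + 1) * ((mhat + n) * lg) ≤ m := by
    refine le_trans ?_ hm
    have h1 : (mhat + n) * lg ≤ (mhat : ℝ) * lg + n * L ^ 2 * lg := by
      have : (n : ℝ) * lg ≤ n * L ^ 2 * lg := by
        have : (1 : ℝ) ≤ L ^ 2 := one_le_pow₀ hL1
        have h0 : 0 ≤ (n : ℝ) * lg := by positivity
        nlinarith
      linarith
    have h2 : 0 ≤ (mhat : ℝ) * lg + n * L ^ 2 * lg := by positivity
    calc 16 * ((a : ℝ) + 1) * ((mhat + n) * lg)
        ≤ 16 * ((a : ℝ) + 1) * ((mhat : ℝ) * lg + n * L ^ 2 * lg) := by gcongr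
      _ ≤ _ := by
        refine mul_le_mul_of_nonneg_right ?_ h2
        linarith
  have hs : ((numClasses G).val : ℝ) ≤ (a + 1) * lg := by
    have h1 : ((numClasses G).val : ℝ) ≤ (Nat.log 2 (n ^ a) : ℕ) + 1 := by
      exact_mod_cast numClasses_val_le_of_weight_le ha
    have h2 := Real.natLog_le_logb (n ^ a) 2
    rw [Nat.cast_pow, Real.logb_pow] at h2
    push_cast at h2
    linarith
  -- Half for the heavy arcs, and 1/16 for the small classes and leftovers of the `O(log n)`
  -- classes.
  have hBm : (Multiset.card B : ℝ) ≤ m / 2 + m / 16 := by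
    have h1 : (Multiset.card B : ℝ) ≤ ((List.finRange G.length).countP (IsHeavy G r ·) : ℝ) +
        (numClasses G).val * (θ + mhat) := by exact_mod_cast hB
    have h2 := two_mul_countP_heavy_le hn hE hr
    have hθ' : (θ : ℝ) ≤ n := by exact_mod_cast hθ
    have h3 : ((numClasses G).val : ℝ) * (θ + mhat) ≤ ((a + 1) * lg) * (n + mhat) := by gcongr
    linarith
  -- outside the exceptional events the output is as desired
  have hgood : ∀ σ : ι → Bool,
      (∀ y, (signSum (fun i => S * (Z i).mat * S) σ *ᵥ y) ⬝ᵥ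
        (signSum (fun i => S * (Z i).mat * S) σ *ᵥ y) ≤
          4 * p * (8 * ((L : ℝ) ^ 2 * (16 * n / m))) * (y ⬝ᵥ y)) →
      (∑ i, sgn (σ i) * ((Multiset.card (Z i).cw : ℝ) - Multiset.card (Z i).ccw)) ^ 2 ≤
        4 * p * (L * m) →
      ((g σ).1.length : ℝ) ≤ 15 / 16 * m ∧
      approxError G (g σ).1 ≤ √(512 * (c + 4)) * √((n : ℝ) * (L : ℝ) ^ 2 * lg / m) := by
    intro σ h1 h2
    constructor
    · have h3 := two_mul_length_output hG (hout σ)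
      -- From `41 p L ≤ m` the square `4 p L m` is at most `4/41 m²`, and 41 is the least integer
      -- with `4/41 ≤ (5/16)²`. Then `2|H| ≤ (9/16 + 1 + 5/16) m`, which is `15/8 m`.
      have h4 : ∑ i, sgn (σ i) * ((Multiset.card (Z i).cw : ℝ) - Multiset.card (Z i).ccw) ≤
          5 / 16 * m := by
        refine abs_le_of_sq_le_sq' (h2.trans ?_) (by positivity) |>.2
        have h5 : (41 : ℝ) * p * L ≤ m := by
          refine le_trans ?_ hmL
          calc (41 : ℝ) * p * L ≤ 41 * ((c + 4) * lg) * (n * L ^ 2) := by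
                gcongr
                nlinarith
            _ = _ := by ring
        nlinarith
      rw [← hmdef] at h3
      linarith
    · rw [approxError, dirLaplacian_sub_output hG (hout σ), ← Real.sqrt_mul (by positivity)]
      have e : S * -(∑ i, sgn (σ i) • (Z i).mat) * S =
          -signSum (fun i => S * (Z i).mat * S) σ := by
        rw [signSum, Matrix.mul_neg, Matrix.neg_mul, Matrix.mul_sum, Matrix.sum_mul]
        simp only [Matrix.mul_smul, Matrix.smul_mul]
      rw [← hS, e]
      refine (opNorm_le_sqrt (t := 4 * p * (8 * ((L : ℝ) ^ 2 * (16 * n / m)))) fun y => ?_).trans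
        (Real.sqrt_le_sqrt ?_)
      · rw [neg_mulVec, neg_dotProduct_neg]
        exact h1 y
      -- The constant is `512 = 4 * 8 * 16`: the tail threshold, the variance and the leverage of
      -- light arcs.
      · calc 4 * (p : ℝ) * (8 * ((L : ℝ) ^ 2 * (16 * n / m)))
            ≤ 4 * ((c + 4) * lg) * (8 * ((L : ℝ) ^ 2 * (16 * n / m))) := by gcongr
          _ = _ := by ring
  refine ofReal_le_prob hdist (fun σ hσ => ?_) ((Nat.cast_le.2 (Finset.card_union_le _ _)).trans
    ((Nat.cast_add _ _).le.trans ((add_le_add hbad₁ hbad₂).trans ?_)))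
  · rw [Finset.mem_union, not_or, Finset.mem_filter, Finset.mem_filter] at hσ
    exact hgood σ (not_not.1 fun h => hσ.1 ⟨Finset.mem_univ σ, h⟩)
      (not_not.1 fun h => hσ.2 ⟨Finset.mem_univ σ, h⟩)
  have h2 : (0 : ℝ) ≤ 2 ^ Fintype.card ι := by positivity
  calc _ = ((2 * n + 1) * (1 / 2 : ℝ) ^ p) * 2 ^ Fintype.card ι := by ring
    _ ≤ _ := mul_le_mul_of_nonneg_right hpδ h2

end Probability
end CycleSparsify

/-! ### Correctness, quality and running time of one round -/

theorem lemma3 (a : ℕ) :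
    ∃ K : ℕ, ∀ c : ℝ, 0 < c → ∃ C E : ℝ, 0 < C ∧ 0 < E ∧
      ∀ (n : ℕ), 2 ≤ n → ∀ (mhat L : ℕ) (T : ℕ → ℕ) (CD : CycleAlg n),
        IsShortCycleAlg CD mhat L T →
      ∀ θ : ℕ, 1 ≤ θ → θ ≤ n →
      ∀ (G : DiGraph n) (r : Fin G.length → ℝ),
        Loopless G → StronglyConnected G → IsEulerian G → PowTwoWeights G →
        (∀ e ∈ G, e.weight ≤ n ^ a) → ApproxEffRes 2 G r →
        -- the output is always Eulerian, and its weights are powers of two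
        (∀ out ∈ (cycleSparsifyOnce CD θ G r).outcomes,
          IsEulerian out.1 ∧ PowTwoWeights out.1) ∧
        -- sparsity and approximation error, with high probability
        (C * ((mhat : ℝ) * Real.logb 2 n + (n : ℝ) * (L : ℝ) ^ 2 * Real.logb 2 n)
            ≤ (G.length : ℝ) →
          ENNReal.ofReal (1 - (n : ℝ) ^ (-c)) ≤
            (cycleSparsifyOnce CD θ G r).prob fun H =>
              (H.length : ℝ) ≤ 15 / 16 * (G.length : ℝ) ∧
              approxError G H ≤
                E * Real.sqrt ((n : ℝ) * (L : ℝ) ^ 2 * Real.logb 2 n / (G.length : ℝ))) ∧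
        -- running time
        (Monotone T → SuperAdditiveFrom θ T →
          ∀ out ∈ (cycleSparsifyOnce CD θ G r).outcomes,
            out.2 ≤ K * G.length + T G.length) := by
  -- The run costs `37 m + 8 s + 2` besides the decompositions, where the number of classes
  -- satisfies `s ≤ a m + 1`; the constant 10 that remains is absorbed by `10 m`.
  refine ⟨47 + 8 * a, fun c hc => ⟨16 * (a + 1) + 41 * (c + 4), √(512 * (c + 4)), by positivity,
    by positivity, ?_⟩⟩
  intro n hn mhat L T CD hCD θ _ hθ G r hl hC hE hp ha hr
  obtain ⟨ι, _, _, B, Z, g, hdist, hout, hG, hZ, -, -, htime⟩ :=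
    cycleSparsifyOnce_run (θ := θ) hCD hl hp r
  have houtcomes : ∀ out ∈ (cycleSparsifyOnce CD θ G r).outcomes, ∃ σ, out = g σ := by
    intro out h
    have h' : out ∈ (cycleSparsifyOnce CD θ G r).dist.support := h
    rw [hdist, PMF.support_map] at h'
    obtain ⟨σ, -, rfl⟩ := h'
    exact ⟨σ, rfl⟩
  refine ⟨fun out h => ?_, fun hm => cycleSparsifyOnce_prob hc hn hCD hθ hl hC hE hp ha hr hm,
    fun hmono hsup out h => ?_⟩
  · obtain ⟨σ, rfl⟩ := houtcomes out h
    exact ⟨output_isEulerian hE hZ hG (hout σ), output_powTwoWeights hp hG (hout σ)⟩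
  · obtain ⟨σ, rfl⟩ := houtcomes out h
    have h1 := htime hmono hsup σ
    have h2 := card_le_length hn hC
    have h3 := numClasses_val_le_of_weight_le ha
    have h4 : Nat.log 2 (n ^ a) ≤ a * n := by
      calc Nat.log 2 (n ^ a) ≤ Nat.log 2 (2 ^ (a * n)) := by
            refine Nat.log_mono_right ?_
            rw [mul_comm, pow_mul]
            exact Nat.pow_le_pow_left n.lt_two_pow_self.le a
        _ = a * n := Nat.log_pow Nat.one_lt_two _
    have h5 : a * n ≤ a * G.length := Nat.mul_le_mul_left a h2
    rw [add_mul, mul_assoc]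
    omega
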